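/- Let $p$ be a prime and $n\ge 1$. For $m\le n$ and a matrix $B\in\mathrm{Mat}_{m\times n}(\mathbb{Q}_p)$ of rank $m$, the singular numbers $\mathrm{SN}(B)=(\mathrm{SN}(B)_1\ge\dots\ge \mathrm{SN}(B)_m)\in\mathbb{Z}^m$ are defined by $B=U\,\mathrm{diag}_{m\times n}(p^{\mathrm{SN}(B)_1},\dots,p^{\mathrm{SN}(B)_m})\,V$ with $U\in \mathrm{GL}_m(\mathbb{Z}_p)$, $V\in \mathrm{GL}_n(\mathbb{Z}_p)$, and $|\mathrm{SN}(B)|:=\sum_{j}\mathrm{SN}(B)_j$. For $A\in\mathrm{GL}_n(\mathbb{Q}_p)$ and $1\le i\le n$ let $A^{(i)}$ be the corner formed by the last $n-i+1$ rows and all $n$ columns of $A$, and put $|\mathrm{SN}(A^{(n+1)})|:=0$. Let $A_1,A_2,\dots\in \mathrm{GL}_n(\mathbb{Q}_p)$ be i.i.d. random matrices whose law is invariant under left and right multiplication by $\mathrm{GL}_n(\mathbb{Z}_p)$. Suppose that it is not the case that almost surely all entries of $\mathrm{SN}(A_1)$ are equal, i.e. $\sum_{M\in\mathbb{Z}}\mathbf{P}(\mathrm{SN}(A_1)=(M,\dots,M))<1$,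 and that $|\mathrm{SN}(A_1^{(i)})|$ is integrable for all $1\le i\le n$. Write $m_i:=\mathbb{E}|\mathrm{SN}(A_1^{(i)})|-\mathbb{E}|\mathrm{SN}(A_1^{(i+1)})|$ for $1\le i\le n$, and let $v(k)\in\mathbb{Z}^n$ ($k\ge 0$) be defined by $v_i(k)+\dots+v_n(k)=\sum_{j=1}^k|\mathrm{SN}(A_j^{(i)})|$ for $1\le i\le n$. Then: 1. $m_n<m_{n-1}<\dots<m_1$. 2. Almost surely $v$ is split, that is, for all $1\le i\le n-1$, $\lim_{k\to\infty}\bigl(v_i(k)-v_{i+1}(k+1)+\mathrm{SN}(A_{k+1})_n\bigr)=+\infty$. 3. (Strong law of large numbers) Almost surely, for all $1\le i\le n$, $\dfrac{\mathrm{SN}(A_1A_2\cdots A_k)_i}{k}\to m_i$ as $k\to\infty$. 4. (Central limit theorem) If moreover $\mathbb{E}\,|\mathrm{SN}(A_1^{(i)})|^2<\infty$ for all $1\le i\le n$, then, as $k\to\infty$, $$\frac{\bigl(\mathrm{SN}(A_1\cdots A_k)_1-k\,m_1,\ \dots,\ \mathrm{SN}(A_1\cdots A_k)_n-k\,m_n\bigr)}{\sqrt{k}}\Rightarrow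 N(0,\Sigma)$$ in distribution, where $\Sigma$ is the covariance matrix of the random vector $\bigl(|\mathrm{SN}(A_1^{(i)})|-|\mathrm{SN}(A_1^{(i+1)})|\bigr)_{1\le i\le n}$. -/

import Mathlib

open MeasureTheory ProbabilityTheory Filter Topology
open scoped Matrix MatrixGroups

namespace PadicProducts

noncomputable section

/-- `GL_n(ℚ_p)` carries its Borel σ-algebra. -/
instance instMeasurableSpaceGL {p : ℕ} [Fact p.Prime] {n : ℕ} :
    MeasurableSpace (GL (Fin n) ℚ_[p]) :=
  borel _

instance instBorelSpaceGL {p : ℕ} [Fact p.Prime] {n : ℕ} :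
    BorelSpace (GL (Fin n) ℚ_[p]) :=
  ⟨rfl⟩

/-- The inclusion `GL_n(ℤ_p) → GL_n(ℚ_p)`. -/
def integralGL (p : ℕ) [Fact p.Prime] (n : ℕ) : GL (Fin n) ℤ_[p] →* GL (Fin n) ℚ_[p] :=
  Matrix.GeneralLinearGroup.map PadicInt.Coe.ringHom

/-- The `m × n` matrix with diagonal entries `p ^ l_1, …, p ^ l_m` and all other entries `0`. -/
def powDiagonal (p : ℕ) [Fact p.Prime] {m : ℕ} (n : ℕ) (l : Fin m → ℤ) :
    Matrix (Fin m) (Fin n) ℚ_[p] :=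
  Matrix.of fun r c => if r.val = c.val then (p : ℚ_[p]) ^ l r else 0

/-- `l = (l_1 ≥ … ≥ l_m)` is the vector of singular numbers of the `m × n` matrix `B`
(`m ≤ n`, of rank `m`): `B = U diag(p ^ l_1, …, p ^ l_m) V`
with `U ∈ GL_m(ℤ_p)` and `V ∈ GL_n(ℤ_p)`. -/
def IsSingularNumbers {p : ℕ} [Fact p.Prime] {m n : ℕ}
    (B : Matrix (Fin m) (Fin n) ℚ_[p]) (l : Fin m → ℤ) : Prop :=
  Antitone l ∧ ∃ (U : GL (Fin m) ℤ_[p]) (V : GL (Fin n) ℤ_[p]),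
    B = (integralGL p m U : Matrix (Fin m) (Fin m) ℚ_[p]) * powDiagonal p n l *
      (integralGL p n V : Matrix (Fin n) (Fin n) ℚ_[p])

open Classical in
/-- The singular numbers `SN(B)` of an `m × n` matrix `B` of rank `m ≤ n`, in decreasing order.
(For other matrices the value is irrelevant.) -/
def SN {p : ℕ} [Fact p.Prime] {m n : ℕ} (B : Matrix (Fin m) (Fin n) ℚ_[p]) : Fin m → ℤ :=
  if h : ∃ l, IsSingularNumbers B l then h.choose else 0

/-- The corner consisting of the last `n - i` rows and all `n` columns of `g`. With rows
counted from `0`, these are the rows `i, i + 1, …, n - 1`; it is empty for `i = n`. -/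
def corner {p : ℕ} [Fact p.Prime] {n : ℕ} (g : GL (Fin n) ℚ_[p]) (i : ℕ) :
    Matrix (Fin (n - i)) (Fin n) ℚ_[p] :=
  Matrix.of fun r c => (g : Matrix (Fin n) (Fin n) ℚ_[p]) ⟨i + r.val, by omega⟩ c

/-- The weight `|SN|` of a corner: the sum of its singular numbers. -/
def cornerWeight {p : ℕ} [Fact p.Prime] {n : ℕ} (g : GL (Fin n) ℚ_[p]) (i : ℕ) : ℤ :=
  ∑ r, SN (corner g i) r

/-- The weight of the empty corner is `0`. -/
theorem cornerWeight_self {p : ℕ} [Fact p.Prime] {n : ℕ} (g : GL (Fin n) ℚ_[p]) :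
    cornerWeight g n = 0 := by
  have : IsEmpty (Fin (n - n)) := by rw [Nat.sub_self]; infer_instance
  simp [cornerWeight]

/-- The sequence `v(0), v(1), …` in `ℤ^n` obtained by adding up the differences of successive
corner weights of the matrices `A_1 = A 0, A_2 = A 1, …`. It is the sequence determined by
`cornerSequence_sum` below. -/
def cornerSequence {p : ℕ} [Fact p.Prime] {n : ℕ} (A : ℕ → GL (Fin n) ℚ_[p])
    (k : ℕ) (i : Fin n) : ℤ :=
  ∑ j ∈ Finset.range k, (cornerWeight (A j) i - cornerWeight (A j) (i + 1))

/-- The defining property of `v`: the sum of `v_m(k)` over `m ≥ i` is the sum of the weights of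
the `i`-th corners of `A_1, …, A_k`. -/
theorem cornerSequence_sum {p : ℕ} [Fact p.Prime] {n : ℕ} (A : ℕ → GL (Fin n) ℚ_[p])
    (k : ℕ) (i : Fin n) :
    ∑ m ∈ Finset.Ici i, cornerSequence A k m
      = ∑ j ∈ Finset.range k, cornerWeight (A j) i := by
  unfold cornerSequence
  rw [Finset.sum_comm]
  refine Finset.sum_congr rfl fun j _ => ?_
  have h1 : ∑ m ∈ Finset.Ici i, (cornerWeight (A j) m - cornerWeight (A j) (m + 1))
      = ∑ m ∈ Finset.Ico (i : ℕ) n, (cornerWeight (A j) m - cornerWeight (A j) (m + 1)) := by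
    refine Finset.sum_bij (fun m _ => (m : ℕ)) ?_ ?_ ?_ ?_
    · intro m hm
      simpa using Finset.mem_Ici.mp hm
    · intro a _ b _ h
      exact Fin.ext h
    · intro b hb
      rw [Finset.mem_Ico] at hb
      exact ⟨⟨b, hb.2⟩, Finset.mem_Ici.mpr hb.1, rfl⟩
    · intro m _
      rfl
  rw [h1]
  have h2 := Finset.sum_Ico_sub (fun m => cornerWeight (A j) m) (le_of_lt i.isLt)
  rw [cornerWeight_self] at h2
  rw [← neg_inj, ← Finset.sum_neg_distrib]
  simpa using h2

/-- A sequence `u(0), u(1), …` in `ℤ^n` is split (with respect to `A_1 = A 0, A_2 = A 1, …`) if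
`u_i(k) - u_{i+1}(k+1) + SN(A_{k+1})_n → +∞` for every two neighbouring indices `i, i + 1`. -/
def IsSplit {p : ℕ} [Fact p.Prime] {n : ℕ} (A : ℕ → GL (Fin n) ℚ_[p])
    (u : ℕ → Fin n → ℤ) : Prop :=
  ∀ (i : ℕ) (hi : i + 1 < n),
    Tendsto
      (fun k => u k ⟨i, by omega⟩ - u (k + 1) ⟨i + 1, hi⟩
        + SN (A k : Matrix (Fin n) (Fin n) ℚ_[p]) ⟨n - 1, by omega⟩)
      atTop atTop

/-- The product `A_1 A_2 ⋯ A_k`, where `A_{j+1} = A j`. -/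
def partialProd {p : ℕ} [Fact p.Prime] {n : ℕ} (A : ℕ → GL (Fin n) ℚ_[p]) (k : ℕ) :
    GL (Fin n) ℚ_[p] :=
  ((List.range k).map A).prod

/-- A measure on `GL_n(ℚ_p)` that is invariant under left and right multiplication by
`GL_n(ℤ_p)`. -/
def IsBiInvariant {p : ℕ} [Fact p.Prime] {n : ℕ} (ν : Measure (GL (Fin n) ℚ_[p])) : Prop :=
  ∀ U V : GL (Fin n) ℤ_[p],
    ν.map (fun g => integralGL p n U * g * integralGL p n V) = ν

end

end PadicProducts

/-! Write w_i(g) for the weight of the corner of rows i, …, n-1. It is -log_p of the largest maximal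
minor of that corner. If g = TV is an Iwasawa decomposition (T upper triangular, V integral), w_i(g)
is the sum of the valuations of the diagonal entries of T from index i on. Hence w_i(gh) = w_i(g) +
w_i(Vh) with V depending only on g (`exists_cornerWeight_mul`). In the product A_1 ⋯ A_{k+1} this V
is determined by the first k factors, and the law of A_{k+1} is left invariant, so the increment of
w_i is independent of those factors and distributed as w_i(A_1) (`increment_aux`). The corner
weights of the products therefore obey the classical limit theorems.

The singular numbers enter through their tail sums s_i(g), which are -log_p of the largest among all
minors of order n-i. Moving rows to the bottom gives s_i(g) = min over row permutations σ of w_i(σg)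
(`tailSN_eq_inf'`). Each w_i(σ ·) is again a cocycle, with the same mean by invariance, so the
strong law passes to the minimum. For the central limit theorem it suffices that w_i - s_i is tight
along the products (`exists_measure_cornerWeight_sub_tailSN_le`). Left multiplication by integral U
preserves the law of the product and the value of s_i. Along a suitable polynomial curve of such U
the corner minors are polynomials with one large coefficient, so they can be small at only boundedly
many parameters (`exists_card_curveGL_lt`).

The ordering of the means is the expectation of w_{i+1}(g) + w_{i+1}(σg) ≤ w_i(g) + w_{i+2}(g),
where σ swaps rows i and i+1 (`cornerWeight_supermodular`). If the singular numbers of g are not all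
equal, the inequality is strict for some integral left translate of g; invariance turns this into a
strict inequality of means. Splitness follows from this gap and the strong law. -/

namespace PadicProducts

/-! ### Maximal minors and their invariance under integral base change -/

section Minors

variable {p : ℕ} [Fact p.Prime]

/-- Expansion of a determinant whose rows are linear combinations. -/
theorem det_sum_smul_rows {r : ℕ} {ι : Type*} [Fintype ι] [DecidableEq ι] (c : Fin r → ι → ℚ_[p])
    (R : Fin r → ι → Fin r → ℚ_[p]) :
    (Matrix.of fun a => ∑ h, c a h • R a h).det
      = ∑ h : Fin r → ι, (∏ a, c a (h a)) * (Matrix.of fun a => R a (h a)).det := by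
  refine ((Matrix.detRowAlternating (R := ℚ_[p]) (n := Fin r)).toMultilinearMap.map_sum
    fun a h => c a h • R a h).trans (Finset.sum_congr rfl fun h _ => ?_)
  exact (Matrix.detRowAlternating (R := ℚ_[p]) (n := Fin r)).toMultilinearMap.map_smul_univ
    (fun a => c a (h a)) (fun a => R a (h a))

/-- Expansion of the maximal minors of a product `B * V` along the columns of `B`. -/
theorem det_submatrix_mul {r n k : ℕ} (B : Matrix (Fin r) (Fin n) ℚ_[p])
    (V : Matrix (Fin n) (Fin k) ℚ_[p]) (J : Fin r → Fin k) :
    ((B * V).submatrix id J).det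
      = ∑ f : Fin r → Fin n, (∏ j, V (f j) (J j)) * (B.submatrix id f).det := by
  have h1 : ((B * V).submatrix id J)ᵀ
      = Matrix.of fun j => ∑ c : Fin n, V c (J j) • fun a => B a c := by
    ext j a
    simp [Matrix.mul_apply, Finset.sum_apply, mul_comm]
  rw [← Matrix.det_transpose, h1, det_sum_smul_rows]
  refine Finset.sum_congr rfl fun f _ => ?_
  rw [← Matrix.det_transpose (B.submatrix id f)]
  rfl

theorem norm_det_le_one {r : ℕ} (M : Matrix (Fin r) (Fin r) ℚ_[p]) (h : ∀ i j, ‖M i j‖ ≤ 1) :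
    ‖M.det‖ ≤ 1 := by
  rw [Matrix.det_apply]
  refine IsUltrametricDist.norm_sum_le_of_forall_le_of_nonneg zero_le_one fun σ _ => ?_
  rw [Units.smul_def, zsmul_eq_mul, norm_mul, norm_prod]
  refine mul_le_one₀ (Padic.norm_int_le_one _) (by positivity) ?_
  exact Finset.prod_le_one (fun _ _ => norm_nonneg _) fun _ _ => h _ _

theorem norm_det_submatrix_mul_le {r n k : ℕ} (B : Matrix (Fin r) (Fin n) ℚ_[p])
    (V : Matrix (Fin n) (Fin k) ℚ_[p]) (hV : ∀ i j, ‖V i j‖ ≤ 1) (J : Fin r → Fin k) {C : ℝ}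
    (hC : 0 ≤ C) (hB : ∀ f : Fin r → Fin n, ‖(B.submatrix id f).det‖ ≤ C) :
    ‖((B * V).submatrix id J).det‖ ≤ C := by
  rw [det_submatrix_mul]
  refine IsUltrametricDist.norm_sum_le_of_forall_le_of_nonneg hC fun f _ => ?_
  rw [norm_mul, norm_prod]
  refine (mul_le_of_le_one_left (norm_nonneg _) ?_).trans (hB f)
  exact Finset.prod_le_one (fun _ _ => norm_nonneg _) fun _ _ => hV _ _

/-- The largest absolute value of a maximal minor of an `m × n` matrix. -/
noncomputable def minorNorm {m n : ℕ} (B : Matrix (Fin m) (Fin n) ℚ_[p]) : ℝ :=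
  ‖fun J : Fin m → Fin n => (B.submatrix id J).det‖

theorem minorNorm_nonneg {m n : ℕ} (B : Matrix (Fin m) (Fin n) ℚ_[p]) : 0 ≤ minorNorm B :=
  norm_nonneg _

theorem norm_det_le_minorNorm {m n : ℕ} (B : Matrix (Fin m) (Fin n) ℚ_[p]) (J : Fin m → Fin n) :
    ‖(B.submatrix id J).det‖ ≤ minorNorm B :=
  norm_le_pi_norm (fun J : Fin m → Fin n => (B.submatrix id J).det) J

theorem minorNorm_le {m n : ℕ} {B : Matrix (Fin m) (Fin n) ℚ_[p]} {C : ℝ} (hC : 0 ≤ C)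
    (h : ∀ J : Fin m → Fin n, ‖(B.submatrix id J).det‖ ≤ C) : minorNorm B ≤ C :=
  (pi_norm_le_iff_of_nonneg hC).2 h

theorem minorNorm_mul_le {m n k : ℕ} (B : Matrix (Fin m) (Fin n) ℚ_[p])
    (V : Matrix (Fin n) (Fin k) ℚ_[p]) (hV : ∀ i j, ‖V i j‖ ≤ 1) :
    minorNorm (B * V) ≤ minorNorm B :=
  minorNorm_le (minorNorm_nonneg _) fun J =>
    norm_det_submatrix_mul_le B V hV J (minorNorm_nonneg _) (norm_det_le_minorNorm B)

theorem minorNorm_mul_left {m n : ℕ} (T : Matrix (Fin m) (Fin m) ℚ_[p])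
    (B : Matrix (Fin m) (Fin n) ℚ_[p]) : minorNorm (T * B) = ‖T.det‖ * minorNorm B := by
  unfold minorNorm
  rw [← norm_smul]
  congr 1
  ext J
  have : (T * B).submatrix id J = T * B.submatrix id J := by
    ext i j
    simp [Matrix.mul_apply]
  rw [this, Matrix.det_mul, Pi.smul_apply, smul_eq_mul]

theorem norm_integralGL_le_one {n : ℕ} (V : GL (Fin n) ℤ_[p]) (i j : Fin n) :
    ‖(integralGL p n V : Matrix (Fin n) (Fin n) ℚ_[p]) i j‖ ≤ 1 :=
  PadicInt.norm_le_one ((V : Matrix (Fin n) (Fin n) ℤ_[p]) i j)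

theorem integralGL_mul_inv {n : ℕ} (V : GL (Fin n) ℤ_[p]) :
    (integralGL p n V : Matrix (Fin n) (Fin n) ℚ_[p]) * (integralGL p n V⁻¹ : Matrix _ _ _) = 1 := by
  rw [← Units.val_mul, ← map_mul, mul_inv_cancel, map_one, Units.val_one]

theorem norm_det_integralGL {n : ℕ} (V : GL (Fin n) ℤ_[p]) :
    ‖(integralGL p n V : Matrix (Fin n) (Fin n) ℚ_[p]).det‖ = 1 := by
  have h := congrArg (fun M => ‖Matrix.det M‖) (integralGL_mul_inv V)
  simp only [Matrix.det_mul, norm_mul, Matrix.det_one, norm_one] at h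
  have h1 := norm_det_le_one _ (norm_integralGL_le_one V)
  have h2 := norm_det_le_one _ (norm_integralGL_le_one V⁻¹)
  refine le_antisymm h1 ?_
  rw [← h]
  exact mul_le_of_le_one_right (norm_nonneg _) h2

theorem minorNorm_mul_integralGL {m n : ℕ} (B : Matrix (Fin m) (Fin n) ℚ_[p])
    (V : GL (Fin n) ℤ_[p]) :
    minorNorm (B * (integralGL p n V : Matrix (Fin n) (Fin n) ℚ_[p])) = minorNorm B := by
  refine le_antisymm (minorNorm_mul_le B _ (norm_integralGL_le_one V)) ?_
  have h := minorNorm_mul_le (B * (integralGL p n V : Matrix (Fin n) (Fin n) ℚ_[p])) _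
    (norm_integralGL_le_one V⁻¹)
  rwa [Matrix.mul_assoc, integralGL_mul_inv, Matrix.mul_one] at h

theorem minorNorm_integralGL_mul {m n : ℕ} (B : Matrix (Fin m) (Fin n) ℚ_[p])
    (U : GL (Fin m) ℤ_[p]) :
    minorNorm ((integralGL p m U : Matrix (Fin m) (Fin m) ℚ_[p]) * B) = minorNorm B := by
  rw [minorNorm_mul_left, norm_det_integralGL, one_mul]

theorem det_powDiagonal_submatrix {r m n : ℕ} (l : Fin m → ℤ) (I : Fin r → Fin m)
    (J : Fin r → Fin n) :
    ((powDiagonal p n l).submatrix I J).det = (∏ a, (p : ℚ_[p]) ^ l (I a)) *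
      (Matrix.of fun a b => if (I a).val = (J b).val then (1 : ℚ_[p]) else 0).det := by
  rw [← Matrix.det_mul_column]
  congr 1
  ext a b
  simp [powDiagonal]

theorem norm_prod_zpow {ι : Type*} (s : Finset ι) (l : ι → ℤ) :
    ‖∏ a ∈ s, (p : ℚ_[p]) ^ l a‖ = (p : ℝ) ^ (-∑ a ∈ s, l a) := by
  have hp : (p : ℝ) ≠ 0 := by exact_mod_cast (Fact.out : p.Prime).ne_zero
  classical
  induction s using Finset.induction_on with
  | empty => simp
  | insert a s ha ih =>
    rw [Finset.prod_insert ha, Finset.sum_insert ha, norm_mul, ih, neg_add, zpow_add₀ hp,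
      Padic.norm_p_zpow]

theorem norm_det_powDiagonal_submatrix_le {r m n : ℕ} (l : Fin m → ℤ) (I : Fin r → Fin m)
    (J : Fin r → Fin n) :
    ‖((powDiagonal p n l).submatrix I J).det‖ ≤ (p : ℝ) ^ (-∑ a, l (I a)) := by
  rw [det_powDiagonal_submatrix, norm_mul, norm_prod_zpow]
  refine mul_le_of_le_one_right (by positivity) (norm_det_le_one _ fun a b => ?_)
  rw [Matrix.of_apply]
  split_ifs <;> simp

theorem norm_det_powDiagonal_submatrix_eq {r m n : ℕ} (l : Fin m → ℤ) (I : Fin r → Fin m)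
    (hI : Function.Injective I) (J : Fin r → Fin n) (hJ : ∀ a, (I a).val = (J a).val) :
    ‖((powDiagonal p n l).submatrix I J).det‖ = (p : ℝ) ^ (-∑ a, l (I a)) := by
  have : (Matrix.of fun a b => if (I a).val = (J b).val then (1 : ℚ_[p]) else 0) = 1 := by
    ext a b
    simp [← hJ, Matrix.one_apply, Fin.val_inj, hI.eq_iff]
  rw [det_powDiagonal_submatrix, this, Matrix.det_one, mul_one, norm_prod_zpow]

theorem minorNorm_powDiagonal {m n : ℕ} (hmn : m ≤ n) (l : Fin m → ℤ) :
    minorNorm (powDiagonal p n l) = (p : ℝ) ^ (-∑ a, l a) := by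
  refine le_antisymm (minorNorm_le (by positivity) fun J =>
    norm_det_powDiagonal_submatrix_le l id J) ?_
  have h := norm_det_powDiagonal_submatrix_eq (p := p) l id Function.injective_id
    (Fin.castLE hmn) (fun _ => rfl)
  simp only [id] at h
  rw [← h]
  exact norm_det_le_minorNorm _ _

/-- The largest maximal minor is unchanged by integral U and V, so it can be read off the diagonal
form. This pins down |SN| although `SN` is defined by choice; uniqueness of the singular numbers is
not needed separately. -/
theorem IsSingularNumbers.minorNorm_eq {m n : ℕ} (hmn : m ≤ n)
    {B : Matrix (Fin m) (Fin n) ℚ_[p]} {l : Fin m → ℤ} (h : IsSingularNumbers B l) :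
    minorNorm B = (p : ℝ) ^ (-∑ a, l a) := by
  obtain ⟨-, U, V, rfl⟩ := h
  rw [minorNorm_mul_integralGL, minorNorm_integralGL_mul, minorNorm_powDiagonal hmn]

end Minors

/-! ### Smith normal form and existence of singular numbers -/

section Smith

variable {p : ℕ} [Fact p.Prime]

open Module

/-- Smith normal form of a family of independent vectors over `ℤ_p`, in terms of bases. -/
theorem exists_smith_bases {m n : ℕ} (C : Fin m → Fin n → ℤ_[p])
    (hC : LinearIndependent ℤ_[p] C) :
    ∃ (hmn : m ≤ n) (e : Fin m → ℕ) (bN : Basis (Fin m) ℤ_[p] (Submodule.span ℤ_[p] (Set.range C)))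
      (bM : Basis (Fin n) ℤ_[p] (Fin n → ℤ_[p])), Antitone e ∧
      ∀ j, (bN j : Fin n → ℤ_[p]) = (p : ℤ_[p]) ^ e j • bM (Fin.castLE hmn j) := by
  obtain ⟨k, s⟩ := Submodule.smithNormalForm (Pi.basisFun ℤ_[p] (Fin n))
    (Submodule.span ℤ_[p] (Set.range C))
  have hk : k = m := by
    simpa using Fintype.card_congr (s.bN.indexEquiv (Basis.span hC))
  subst hk
  have ha : ∀ j, s.a j ≠ 0 := by
    intro j h0
    have h := s.snf j
    rw [h0, zero_smul] at h
    exact s.bN.ne_zero j (Subtype.ext h)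
  have hmn : k ≤ n := by simpa using Fintype.card_le_of_embedding s.f
  -- Sorting in the order dual lists the valuations decreasingly. The ambient basis is then permuted
  -- so that its first vectors follow this order, and the unit parts of the coefficients are
  -- absorbed into the basis of the submodule.
  let σ : Equiv.Perm (Fin k) := Tuple.sort (fun j => OrderDual.toDual (s.a j).valuation)
  have hσ : Monotone ((fun j => OrderDual.toDual (s.a j).valuation) ∘ σ) := Tuple.monotone_sort _
  obtain ⟨g, hg⟩ : ∃ g : Equiv.Perm (Fin n), ∀ j : Fin k, g (Fin.castLE hmn j) = s.f (σ j) := by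
    obtain ⟨g, hg⟩ := Equiv.Perm.exists_extending_pair (Fin.castLE hmn) (fun j => s.f (σ j))
      (Fin.castLE_injective hmn) (s.f.injective.comp σ.injective)
    exact ⟨g, hg⟩
  refine ⟨hmn, fun j => (s.a (σ j)).valuation,
    (s.bN.unitsSMul fun j => (PadicInt.unitCoeff (ha j))⁻¹).reindex σ.symm,
    s.bM.reindex g.symm, fun i j hij => hσ hij, fun j => ?_⟩
  rw [Basis.reindex_apply, Equiv.symm_symm, Basis.unitsSMul_apply, Basis.reindex_apply,
    Equiv.symm_symm, hg, Units.smul_def, Submodule.coe_smul, s.snf]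
  nth_rw 2 [PadicInt.unitCoeff_spec (ha (σ j))]
  rw [smul_smul, ← mul_assoc, Units.inv_mul, one_mul]

/-- The transposed base change matrix between two bases, as an element of `GL`. -/
noncomputable def basisGL {R M ι : Type*} [CommRing R] [AddCommGroup M] [Module R M] [Fintype ι]
    [DecidableEq ι] (b b' : Basis ι R M) : (Matrix ι ι R)ˣ where
  val := (b.toMatrix b')ᵀ
  inv := (b'.toMatrix b)ᵀ
  val_inv := by rw [← Matrix.transpose_mul, Basis.toMatrix_mul_toMatrix_flip, Matrix.transpose_one]
  inv_val := by rw [← Matrix.transpose_mul, Basis.toMatrix_mul_toMatrix_flip, Matrix.transpose_one]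

/-- A power p ^ N makes the entries integral; Smith bases for the row span then diagonalise p ^ N B,
and the exponents are shifted back by N. -/
theorem exists_isSingularNumbers {m n : ℕ} (B : Matrix (Fin m) (Fin n) ℚ_[p])
    (hB : LinearIndependent ℚ_[p] fun i => B i) : ∃ l, IsSingularNumbers B l := by
  have hp : (p : ℚ_[p]) ≠ 0 := by exact_mod_cast (Fact.out : p.Prime).ne_zero
  have hp1 : (1 : ℝ) < p := by exact_mod_cast (Fact.out : p.Prime).one_lt
  obtain ⟨N, hN⟩ : ∃ N : ℕ, ∀ i j, ‖(p : ℚ_[p]) ^ N * B i j‖ ≤ 1 := by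
    obtain ⟨N, hN⟩ := pow_unbounded_of_one_lt (∑ i, ∑ j, ‖B i j‖) hp1
    refine ⟨N, fun i j => ?_⟩
    rw [norm_mul, norm_pow, Padic.norm_p, inv_pow, inv_mul_le_one₀ (by positivity)]
    refine le_trans ?_ hN.le
    refine le_trans ?_ (Finset.single_le_sum (f := fun i => ∑ j, ‖B i j‖)
      (fun _ _ => by positivity) (Finset.mem_univ i))
    exact Finset.single_le_sum (f := fun j => ‖B i j‖) (fun _ _ => by positivity)
      (Finset.mem_univ j)
  let C : Fin m → Fin n → ℤ_[p] := fun i j => ⟨(p : ℚ_[p]) ^ N * B i j, hN i j⟩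
  have hCB : ∀ i j, ((C i j : ℤ_[p]) : ℚ_[p]) = (p : ℚ_[p]) ^ N * B i j := fun _ _ => rfl
  have hC : LinearIndependent ℤ_[p] C := by
    rw [Fintype.linearIndependent_iff] at hB ⊢
    intro c hc i
    have := hB (fun i => (c i : ℚ_[p])) ?_ i
    · exact Subtype.ext this
    · ext j
      have h := congrArg (fun x : ℤ_[p] => (x : ℚ_[p])) (congrFun hc j)
      simp only [Finset.sum_apply, Pi.smul_apply, smul_eq_mul, Pi.zero_apply, PadicInt.coe_sum,
        PadicInt.coe_mul, hCB, PadicInt.coe_zero] at h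
      simp only [Finset.sum_apply, Pi.smul_apply, smul_eq_mul, Pi.zero_apply]
      refine (mul_eq_zero.1 ?_).resolve_left (pow_ne_zero N hp)
      rw [← h, Finset.mul_sum]
      exact Finset.sum_congr rfl fun _ _ => by ring
  obtain ⟨hmn, e, bN, bM, he, hb⟩ := exists_smith_bases C hC
  refine ⟨fun j => (e j : ℤ) - N, fun i j hij => by have := he hij; simp only; omega,
    basisGL bN (Basis.span hC), basisGL (Pi.basisFun _ _) bM, ?_⟩
  ext i k
  have h1 : C i k = ∑ j, bN.repr (Basis.span hC i) j * ((p : ℤ_[p]) ^ e j *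
      bM (Fin.castLE hmn j) k) := by
    have h := congrArg (fun x : Submodule.span ℤ_[p] (Set.range C) => (x : Fin n → ℤ_[p]) k)
      (bN.sum_repr (Basis.span hC i))
    simp only [AddSubmonoidClass.coe_finsetSum, Submodule.coe_smul, hb, Finset.sum_apply,
      Pi.smul_apply, smul_eq_mul] at h
    rw [h, Basis.span_apply]
  have h2 := congrArg (fun x : ℤ_[p] => (x : ℚ_[p])) h1
  simp only [PadicInt.coe_sum, PadicInt.coe_mul, PadicInt.coe_pow, PadicInt.coe_natCast,
    hCB] at h2
  have h3 : B i k = (p : ℚ_[p]) ^ (-(N : ℤ)) * ((p : ℚ_[p]) ^ N * B i k) := by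
    rw [zpow_neg, zpow_natCast, inv_mul_cancel_left₀ (pow_ne_zero N hp)]
  rw [h3, h2, Matrix.mul_apply, Finset.mul_sum]
  simp only [Matrix.mul_apply]
  simp only [Finset.sum_mul]
  rw [Finset.sum_comm]
  refine Finset.sum_congr rfl fun j _ => ?_
  rw [Finset.sum_eq_single (Fin.castLE hmn j)]
  · simp only [powDiagonal, Matrix.of_apply, Fin.val_castLE, if_true]
    rw [zpow_sub₀ hp, zpow_neg, zpow_natCast, zpow_natCast]
    change _ = ((bN.repr (Basis.span hC i) j : ℤ_[p]) : ℚ_[p]) * _ *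
      ((bM (Fin.castLE hmn j) k : ℤ_[p]) : ℚ_[p])
    ring
  · intro c _ hc
    have : (j : ℕ) ≠ c := fun h => hc (Fin.ext h.symm)
    simp [powDiagonal, this]
  · simp

end Smith

/-! ### Corner weights and tail sums of singular numbers as sizes of minors -/

section Corners

variable {p : ℕ} [Fact p.Prime] {n : ℕ}

/-- The rows `i, i + 1, …, n - 1`. -/
def lastRow (n i : ℕ) (r : Fin (n - i)) : Fin n := ⟨i + r.val, by omega⟩

theorem lastRow_injective (n i : ℕ) : Function.Injective (lastRow n i) := fun _ _ h =>
  Fin.ext (Nat.add_left_cancel (Fin.ext_iff.1 h))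

theorem lastRow_strictMono (n i : ℕ) : StrictMono (lastRow n i) := fun _ _ h =>
  Nat.add_lt_add_left h i

theorem corner_eq_submatrix (g : GL (Fin n) ℚ_[p]) (i : ℕ) :
    corner g i = (g : Matrix (Fin n) (Fin n) ℚ_[p]).submatrix (lastRow n i) id := rfl

theorem natCast_prime_pos : (0 : ℝ) < p := by exact_mod_cast (Fact.out : p.Prime).pos

theorem one_lt_natCast_prime : (1 : ℝ) < p := by exact_mod_cast (Fact.out : p.Prime).one_lt

theorem isSingularNumbers_SN {m : ℕ} (B : Matrix (Fin m) (Fin n) ℚ_[p])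
    (hB : LinearIndependent ℚ_[p] fun i => B i) : IsSingularNumbers B (SN B) := by
  have h := exists_isSingularNumbers B hB
  rw [SN, dif_pos h]
  exact h.choose_spec

theorem linearIndependent_rows (g : GL (Fin n) ℚ_[p]) :
    LinearIndependent ℚ_[p] fun i => (g : Matrix (Fin n) (Fin n) ℚ_[p]) i :=
  Matrix.linearIndependent_rows_of_isUnit g.isUnit

theorem isSingularNumbers_SN_GL (g : GL (Fin n) ℚ_[p]) :
    IsSingularNumbers (g : Matrix (Fin n) (Fin n) ℚ_[p])
      (SN (g : Matrix (Fin n) (Fin n) ℚ_[p])) :=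
  isSingularNumbers_SN _ (linearIndependent_rows g)

theorem minorNorm_corner (g : GL (Fin n) ℚ_[p]) (i : ℕ) :
    minorNorm (corner g i) = (p : ℝ) ^ (-cornerWeight g i) :=
  (isSingularNumbers_SN (corner g i)
    ((linearIndependent_rows g).comp _ (lastRow_injective n i))).minorNorm_eq (Nat.sub_le n i)

theorem minorNorm_corner_pos (g : GL (Fin n) ℚ_[p]) (i : ℕ) : 0 < minorNorm (corner g i) := by
  rw [minorNorm_corner]
  exact zpow_pos natCast_prime_pos _

theorem cornerWeight_eq_logb (g : GL (Fin n) ℚ_[p]) (i : ℕ) :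
    (cornerWeight g i : ℝ) = -Real.logb p (minorNorm (corner g i)) := by
  rw [minorNorm_corner, ← Real.rpow_intCast,
    Real.logb_rpow natCast_prime_pos one_lt_natCast_prime.ne']
  simp

/-- Passing to the logarithm of the largest minor, which never vanishes on `GL`, removes the choice
hidden in `SN`; all measurability below rests on this. -/
theorem continuous_cornerWeight (i : ℕ) :
    Continuous fun g : GL (Fin n) ℚ_[p] => (cornerWeight g i : ℝ) := by
  simp_rw [cornerWeight_eq_logb, Real.logb]
  refine ((Continuous.log ?_ fun g => (minorNorm_corner_pos g i).ne').div_const _).neg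
  refine continuous_norm.comp (continuous_pi fun J => Continuous.matrix_det ?_)
  exact (Units.continuous_val.matrix_submatrix (lastRow n i) id).matrix_submatrix id J

theorem corner_mul_coe (g : GL (Fin n) ℚ_[p]) (h : GL (Fin n) ℚ_[p]) (i : ℕ) :
    corner (g * h) i = corner g i * (h : Matrix (Fin n) (Fin n) ℚ_[p]) := by
  ext r c
  simp [corner, Matrix.mul_apply]

/-- The sum of the entries with index at least `i`. -/
def tailSum (l : Fin n → ℤ) (i : ℕ) : ℤ := ∑ r, l (lastRow n i r)

theorem image_lastRow (n i : ℕ) :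
    Finset.univ.image (lastRow n i) = Finset.univ.filter fun j : Fin n => i ≤ j := by
  ext j
  simp only [Finset.mem_image, Finset.mem_univ, true_and, Finset.mem_filter, lastRow]
  constructor
  · rintro ⟨r, rfl⟩
    simp
  · intro h
    exact ⟨⟨j - i, by omega⟩, Fin.ext (by simp; omega)⟩

theorem tailSum_eq_filter (l : Fin n → ℤ) (i : ℕ) :
    tailSum l i = ∑ j with i ≤ (j : Fin n).val, l j := by
  rw [← image_lastRow, Finset.sum_image (lastRow_injective n i).injOn, tailSum]

theorem tailSum_eq_add (l : Fin n → ℤ) (i : Fin n) :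
    tailSum l i = l i + tailSum l (i + 1) := by
  rw [tailSum_eq_filter, tailSum_eq_filter, ← Finset.sum_insert]
  · congr 1
    ext j
    simp only [Finset.mem_filter, Finset.mem_univ, true_and, Finset.mem_insert, Fin.ext_iff]
    omega
  · simp

/-- Exchange argument: the image of `I` and the set of last indices have equally many elements
outside each other; those missed by `I` have value at most l_i, those added by `I` at least l_i. -/
theorem tailSum_le_sum {l : Fin n → ℤ} (hl : Antitone l) {i : ℕ} {I : Fin (n - i) → Fin n}
    (hI : Function.Injective I) : tailSum l i ≤ ∑ a, l (I a) := by
  rcases le_or_gt n i with h | h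
  · have : IsEmpty (Fin (n - i)) := by rw [Nat.sub_eq_zero_of_le h]; infer_instance
    simp [tailSum]
  rw [tailSum, ← Finset.sum_image (f := l) (s := Finset.univ) hI.injOn,
    ← Finset.sum_image (f := l) (s := Finset.univ) (lastRow_injective n i).injOn]
  set s := Finset.univ.image I
  set t := Finset.univ.image (lastRow n i)
  have hst : (t \ s).card = (s \ t).card := by
    rw [Finset.card_sdiff_comm]
    rw [Finset.card_image_of_injective _ hI, Finset.card_image_of_injective _ (lastRow_injective n i)]
  have ht : ∀ x, x ∈ t ↔ i ≤ x.val := fun x => by simp [t, image_lastRow]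
  have h1 : ∑ x ∈ t \ s, l x ≤ (t \ s).card • l ⟨i, h⟩ := by
    refine Finset.sum_le_card_nsmul _ _ _ fun x hx => hl ?_
    exact (ht x).1 (Finset.mem_sdiff.1 hx).1
  have h2 : (s \ t).card • l ⟨i, h⟩ ≤ ∑ x ∈ s \ t, l x := by
    refine Finset.card_nsmul_le_sum _ _ _ fun x hx => hl ?_
    have := mt (ht x).2 (Finset.mem_sdiff.1 hx).2
    exact (not_le.1 this).le
  rw [hst] at h1
  rw [← Finset.sum_inter_add_sum_sdiff t s, ← Finset.sum_inter_add_sum_sdiff s t,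
    Finset.inter_comm t s]
  linarith

/-- Minors of a product with an integral matrix are integral combinations of minors of the same
order; the left factor is treated by transposing. -/
theorem norm_det_submatrix_le_of_integral {r : ℕ} {B U V : Matrix (Fin n) (Fin n) ℚ_[p]} {C : ℝ}
    (hC : 0 ≤ C) (hU : ∀ i j, ‖U i j‖ ≤ 1) (hV : ∀ i j, ‖V i j‖ ≤ 1)
    (hB : ∀ I J : Fin r → Fin n, ‖(B.submatrix I J).det‖ ≤ C) (I J : Fin r → Fin n) :
    ‖((U * B * V).submatrix I J).det‖ ≤ C := by
  have key : ∀ (M V : Matrix (Fin n) (Fin n) ℚ_[p]), (∀ i j, ‖V i j‖ ≤ 1) →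
      (∀ I J : Fin r → Fin n, ‖(M.submatrix I J).det‖ ≤ C) →
      ∀ I J : Fin r → Fin n, ‖((M * V).submatrix I J).det‖ ≤ C := by
    intro M V hV hM I J
    exact norm_det_submatrix_mul_le (M.submatrix I id) V hV J hC fun f => hM I f
  refine key _ V hV (fun I J => ?_) I J
  rw [← Matrix.det_transpose, Matrix.transpose_submatrix, Matrix.transpose_mul]
  refine key _ _ (fun i j => hU j i) (fun I J => ?_) J I
  rw [← Matrix.transpose_submatrix, Matrix.det_transpose]
  exact hB J I

theorem IsSingularNumbers.norm_det_submatrix_le {B : Matrix (Fin n) (Fin n) ℚ_[p]}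
    {l : Fin n → ℤ} (h : IsSingularNumbers B l) {i : ℕ} (I J : Fin (n - i) → Fin n) :
    ‖(B.submatrix I J).det‖ ≤ (p : ℝ) ^ (-tailSum l i) := by
  have hp := natCast_prime_pos (p := p)
  obtain ⟨hl, U, V, rfl⟩ := h
  refine norm_det_submatrix_le_of_integral (by positivity) (norm_integralGL_le_one U)
    (norm_integralGL_le_one V) (fun I J => ?_) I J
  by_cases hI : Function.Injective I
  · refine (norm_det_powDiagonal_submatrix_le l I J).trans ?_
    exact zpow_le_zpow_right₀ one_lt_natCast_prime.le (neg_le_neg (tailSum_le_sum hl hI))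
  · obtain ⟨a, b, hab, hne⟩ : ∃ a b, I a = I b ∧ a ≠ b := by
      simpa [Function.Injective] using hI
    rw [Matrix.det_zero_of_row_eq hne (by ext; simp [hab]), norm_zero]
    positivity

/-- The diagonal form is itself an integral transform of B, so its minor in the last rows and
columns cannot exceed the largest minor of B. -/
theorem IsSingularNumbers.exists_norm_det_submatrix_eq {B : Matrix (Fin n) (Fin n) ℚ_[p]}
    {l : Fin n → ℤ} (h : IsSingularNumbers B l) (i : ℕ) :
    ∃ I J : Fin (n - i) → Fin n, ‖(B.submatrix I J).det‖ = (p : ℝ) ^ (-tailSum l i) := by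
  have : Nonempty (Fin (n - i) → Fin n) := ⟨lastRow n i⟩
  obtain ⟨⟨I, J⟩, hIJ⟩ := Finite.exists_max
    fun x : (Fin (n - i) → Fin n) × (Fin (n - i) → Fin n) => ‖(B.submatrix x.1 x.2).det‖
  refine ⟨I, J, le_antisymm (h.norm_det_submatrix_le I J) ?_⟩
  obtain ⟨-, U, V, hB⟩ := h
  have hD : powDiagonal p n l = (integralGL p n U⁻¹ : Matrix (Fin n) (Fin n) ℚ_[p]) * B *
      (integralGL p n V⁻¹ : Matrix (Fin n) (Fin n) ℚ_[p]) := by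
    have hU := integralGL_mul_inv (p := p) U⁻¹
    rw [inv_inv] at hU
    rw [hB, ← Matrix.mul_assoc, ← Matrix.mul_assoc, hU, Matrix.one_mul, Matrix.mul_assoc,
      integralGL_mul_inv, Matrix.mul_one]
  have h1 := norm_det_submatrix_le_of_integral (norm_nonneg _) (norm_integralGL_le_one U⁻¹)
    (norm_integralGL_le_one V⁻¹) (fun I J => hIJ (I, J)) (lastRow n i) (lastRow n i)
  rw [← hD, norm_det_powDiagonal_submatrix_eq l _ (lastRow_injective n i) _ fun _ => rfl] at h1
  exact h1

/-- The sum of the last `n - i` singular numbers of `g`. -/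
noncomputable def tailSN (g : GL (Fin n) ℚ_[p]) (i : ℕ) : ℤ :=
  tailSum (SN (g : Matrix (Fin n) (Fin n) ℚ_[p])) i

theorem SN_eq_tailSN_sub (g : GL (Fin n) ℚ_[p]) (i : Fin n) :
    SN (g : Matrix (Fin n) (Fin n) ℚ_[p]) i = tailSN g i - tailSN g (i + 1) := by
  rw [tailSN, tailSN, tailSum_eq_add]
  ring

theorem tailSN_le_cornerWeight (g : GL (Fin n) ℚ_[p]) (i : ℕ) :
    tailSN g i ≤ cornerWeight g i := by
  rw [← neg_le_neg_iff, ← zpow_le_zpow_iff_right₀ (one_lt_natCast_prime (p := p)),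
    ← minorNorm_corner]
  have hp := natCast_prime_pos (p := p)
  exact minorNorm_le (by positivity) fun J =>
    (isSingularNumbers_SN_GL g).norm_det_submatrix_le (lastRow n i) J

theorem tailSN_integralGL_mul (U : GL (Fin n) ℤ_[p]) (g : GL (Fin n) ℚ_[p]) (i : ℕ) :
    tailSN (integralGL p n U * g) i = tailSN g i := by
  have key : ∀ (U : GL (Fin n) ℤ_[p]) (g : GL (Fin n) ℚ_[p]),
      tailSN g i ≤ tailSN (integralGL p n U * g) i := by
    intro U g
    have hp := natCast_prime_pos (p := p)
    obtain ⟨I, J, h⟩ := (isSingularNumbers_SN_GL (integralGL p n U * g)).exists_norm_det_submatrix_eq i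
    rw [← neg_le_neg_iff, ← zpow_le_zpow_iff_right₀ (one_lt_natCast_prime (p := p)), tailSN, ← h]
    have h1 := norm_det_submatrix_le_of_integral (V := 1) (by positivity)
      (norm_integralGL_le_one U) (fun a b => by
        rw [Matrix.one_apply]; split_ifs <;> simp)
      ((isSingularNumbers_SN_GL g).norm_det_submatrix_le (i := i)) I J
    rwa [Matrix.mul_one] at h1
  refine le_antisymm ?_ (key U g)
  have := key U⁻¹ (integralGL p n U * g)
  rwa [← mul_assoc, ← map_mul, inv_mul_cancel, map_one, one_mul] at this

/-- The permutation matrix of `σ`, whose row `a` is the basis vector with index `σ a`. -/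
noncomputable def permGL (p : ℕ) [Fact p.Prime] {n : ℕ} (σ : Equiv.Perm (Fin n)) : GL (Fin n) ℤ_[p] where
  val := (1 : Matrix (Fin n) (Fin n) ℤ_[p]).submatrix σ id
  inv := (1 : Matrix (Fin n) (Fin n) ℤ_[p]).submatrix id σ
  val_inv := by
    rw [← Matrix.submatrix_mul _ _ _ _ _ Function.bijective_id, Matrix.one_mul,
      Matrix.submatrix_one_equiv]
  inv_val := by
    rw [Matrix.submatrix_mul_equiv, Matrix.one_mul, Matrix.submatrix_id_id]

theorem coe_permGL (σ : Equiv.Perm (Fin n)) :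
    (integralGL p n (permGL p σ) : Matrix (Fin n) (Fin n) ℚ_[p])
      = (1 : Matrix (Fin n) (Fin n) ℚ_[p]).submatrix σ id := by
  ext a b
  change (((1 : Matrix (Fin n) (Fin n) ℤ_[p]) (σ a) b : ℤ_[p]) : ℚ_[p]) = _
  simp only [Matrix.one_apply, Matrix.submatrix_apply, id]
  split_ifs <;> simp

theorem permGL_mul (σ : Equiv.Perm (Fin n)) (M : Matrix (Fin n) (Fin n) ℚ_[p]) :
    (integralGL p n (permGL p σ) : Matrix (Fin n) (Fin n) ℚ_[p]) * M = M.submatrix σ id := by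
  rw [coe_permGL]
  ext a b
  simp [Matrix.mul_apply, Matrix.one_apply]

theorem mul_permGL (σ : Equiv.Perm (Fin n)) (M : Matrix (Fin n) (Fin n) ℚ_[p]) :
    M * (integralGL p n (permGL p σ) : Matrix (Fin n) (Fin n) ℚ_[p]) = M.submatrix id σ.symm := by
  rw [coe_permGL]
  ext a b
  simp only [Matrix.mul_apply, Matrix.submatrix_apply, Matrix.one_apply, id]
  rw [Finset.sum_eq_single (σ.symm b)]
  · simp
  · intro c _ hc
    rw [if_neg (fun h => hc (by rw [← h, Equiv.symm_apply_apply])), mul_zero]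
  · simp

theorem corner_permGL_mul (σ : Equiv.Perm (Fin n)) (g : GL (Fin n) ℚ_[p]) (i : ℕ) :
    corner (integralGL p n (permGL p σ) * g) i
      = (g : Matrix (Fin n) (Fin n) ℚ_[p]).submatrix (σ ∘ lastRow n i) id := by
  rw [corner_eq_submatrix, Units.val_mul, permGL_mul]
  rfl

/-- A permutation moves the rows of a largest minor of order n - i into the corner. -/
theorem exists_cornerWeight_permGL_eq (g : GL (Fin n) ℚ_[p]) (i : ℕ) :
    ∃ σ : Equiv.Perm (Fin n), cornerWeight (integralGL p n (permGL p σ) * g) i = tailSN g i := by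
  obtain ⟨I, J, h⟩ := (isSingularNumbers_SN_GL g).exists_norm_det_submatrix_eq i
  have hp := natCast_prime_pos (p := p)
  have hI : Function.Injective I := by
    intro a b hab
    by_contra hne
    rw [Matrix.det_zero_of_row_eq hne (by ext; simp [hab]), norm_zero] at h
    exact (zpow_pos hp _).ne h
  obtain ⟨σ, hσ⟩ := Equiv.Perm.exists_extending_pair (lastRow n i) I (lastRow_injective n i) hI
  refine ⟨σ, le_antisymm ?_ ?_⟩
  · rw [← neg_le_neg_iff, ← zpow_le_zpow_iff_right₀ (one_lt_natCast_prime (p := p)),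
      ← minorNorm_corner, tailSN, ← h, corner_permGL_mul]
    have : σ ∘ lastRow n i = I := funext hσ
    rw [this]
    exact norm_det_le_minorNorm ((g : Matrix (Fin n) (Fin n) ℚ_[p]).submatrix I id) J
  · rw [← tailSN_integralGL_mul (permGL p σ) g]
    exact tailSN_le_cornerWeight _ _

/-- The bridge from corner weights to singular numbers: measurability and the strong law pass
through this finite minimum. -/
theorem tailSN_eq_inf' (g : GL (Fin n) ℚ_[p]) (i : ℕ) :
    (tailSN g i : ℝ) = Finset.univ.inf' ⟨1, Finset.mem_univ _⟩
      fun σ : Equiv.Perm (Fin n) =>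
        (cornerWeight (integralGL p n (permGL p σ) * g) i : ℝ) := by
  refine le_antisymm (Finset.le_inf' _ _ fun σ _ => ?_) ?_
  · rw [← tailSN_integralGL_mul (permGL p σ)]
    exact_mod_cast tailSN_le_cornerWeight (integralGL p n (permGL p σ) * g) i
  · obtain ⟨σ, hσ⟩ := exists_cornerWeight_permGL_eq g i
    rw [← hσ]
    exact Finset.inf'_le _ (Finset.mem_univ σ)

end Corners

/-! ### Iwasawa decomposition, the cocycle property and supermodularity -/

section Triangular

variable {p : ℕ} [Fact p.Prime] {n : ℕ}

theorem rowMatrix_mul_self {R : Type*} [CommRing R] (i₀ : Fin n) (q : Fin n → R)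
    (hq : q i₀ = 0) :
    (Matrix.of fun a b => if a = i₀ then q b else 0 : Matrix (Fin n) (Fin n) R)
      * (Matrix.of fun a b => if a = i₀ then q b else 0) = 0 := by
  ext a b
  rw [Matrix.mul_apply, Matrix.zero_apply]
  refine Finset.sum_eq_zero fun c _ => ?_
  by_cases hc : c = i₀
  · subst hc
    simp [hq]
  · simp [hc]

/-- The unipotent matrix which differs from the identity only in the row `i₀`, to which `q`
is added. -/
noncomputable def shearGL (i₀ : Fin n) (q : Fin n → ℤ_[p]) (hq : q i₀ = 0) :
    GL (Fin n) ℤ_[p] where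
  val := 1 + Matrix.of fun a b => if a = i₀ then q b else 0
  inv := 1 - Matrix.of fun a b => if a = i₀ then q b else 0
  val_inv := by
    have := rowMatrix_mul_self i₀ q hq
    rw [add_mul, mul_sub, mul_sub, this]
    simp
  inv_val := by
    have := rowMatrix_mul_self i₀ q hq
    rw [sub_mul, mul_add, mul_add, this]
    simp

theorem coe_shearGL (i₀ : Fin n) (q : Fin n → ℤ_[p]) (hq : q i₀ = 0) :
    (integralGL p n (shearGL i₀ q hq) : Matrix (Fin n) (Fin n) ℚ_[p])
      = 1 + Matrix.of fun a b => if a = i₀ then (q b : ℚ_[p]) else 0 := by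
  ext a b
  change (((1 : Matrix (Fin n) (Fin n) ℤ_[p]) a b + if a = i₀ then q b else 0 : ℤ_[p]) : ℚ_[p]) = _
  rw [Matrix.add_apply, Matrix.one_apply, Matrix.one_apply, Matrix.of_apply]
  split_ifs <;> simp

theorem mul_shearGL_apply (M : Matrix (Fin n) (Fin n) ℚ_[p]) (i₀ : Fin n) (q : Fin n → ℤ_[p])
    (hq : q i₀ = 0) (a b : Fin n) :
    (M * (integralGL p n (shearGL i₀ q hq) : Matrix (Fin n) (Fin n) ℚ_[p])) a b
      = M a b + M a i₀ * q b := by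
  rw [coe_shearGL, mul_add, Matrix.mul_one, Matrix.add_apply]
  simp [Matrix.mul_apply]

theorem shearGL_mul_apply (M : Matrix (Fin n) (Fin n) ℚ_[p]) (i₀ : Fin n) (q : Fin n → ℤ_[p])
    (hq : q i₀ = 0) (a b : Fin n) :
    ((integralGL p n (shearGL i₀ q hq) : Matrix (Fin n) (Fin n) ℚ_[p]) * M) a b
      = M a b + if a = i₀ then ∑ c, (q c : ℚ_[p]) * M c b else 0 := by
  rw [coe_shearGL, add_mul, Matrix.one_mul, Matrix.add_apply]
  congr 1
  rw [Matrix.mul_apply]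
  split_ifs with h <;> simp [h]

/-- Column elimination from the bottom row upwards. A pivot of largest norm makes all the quotients
integral. -/
theorem exists_mul_integralGL_triangular_aux (M : Matrix (Fin n) (Fin n) ℚ_[p]) (k : ℕ)
    (hk : k ≤ n) : ∃ V : GL (Fin n) ℤ_[p], ∀ a b : Fin n, n - k ≤ a → b < a →
      (M * (integralGL p n V : Matrix (Fin n) (Fin n) ℚ_[p])) a b = 0 := by
  induction k with
  | zero => exact ⟨1, fun a b h => by omega⟩
  | succ k ih =>
    obtain ⟨V, hV⟩ := ih (by omega)
    set M' := M * (integralGL p n V : Matrix (Fin n) (Fin n) ℚ_[p]) with hM'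
    set i₀ : Fin n := ⟨n - (k + 1), by omega⟩ with hi₀
    obtain ⟨c, hc, hmax⟩ := Finset.exists_max_image (Finset.Iic i₀) (fun c => ‖M' i₀ c‖)
      ⟨i₀, Finset.mem_Iic.2 le_rfl⟩
    rw [Finset.mem_Iic] at hc
    set M'' := M' * (integralGL p n (permGL p (Equiv.swap c i₀)) : Matrix (Fin n) (Fin n) ℚ_[p])
      with hM''
    have hM''a : ∀ a b, M'' a b = M' a (Equiv.swap c i₀ b) := by
      intro a b
      rw [hM'', mul_permGL, Equiv.symm_swap]
      rfl
    have hlow : ∀ a b : Fin n, i₀ < a → b < a → M'' a b = 0 := by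
      intro a b ha hb
      rw [hM''a]
      refine hV _ _ ?_ ?_
      · rw [Fin.lt_def] at ha
        simp only [hi₀] at ha
        omega
      · rcases eq_or_ne b c with rfl | h1
        · rwa [Equiv.swap_apply_left]
        · rcases eq_or_ne b i₀ with rfl | h2
          · rw [Equiv.swap_apply_right]
            exact hc.trans_lt ha
          · rwa [Equiv.swap_apply_of_ne_of_ne h1 h2]
    have hpiv : ∀ b, b < i₀ → ‖M'' i₀ b‖ ≤ ‖M'' i₀ i₀‖ := by
      intro b hb
      rw [hM''a, hM''a, Equiv.swap_apply_right]
      refine hmax _ (Finset.mem_Iic.2 ?_)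
      rcases eq_or_ne b c with rfl | h1
      · rw [Equiv.swap_apply_left]
      · rw [Equiv.swap_apply_of_ne_of_ne h1 hb.ne]
        exact hb.le
    have hq : ∀ b, ‖if b < i₀ then -(M'' i₀ b / M'' i₀ i₀) else 0‖ ≤ 1 := by
      intro b
      split_ifs with hb
      · rw [norm_neg, norm_div]
        exact div_le_one_of_le₀ (hpiv b hb) (norm_nonneg _)
      · simp
    let q : Fin n → ℤ_[p] := fun b => ⟨if b < i₀ then -(M'' i₀ b / M'' i₀ i₀) else 0, hq b⟩
    have hq0 : q i₀ = 0 := Subtype.ext (by simp [q])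
    refine ⟨V * permGL p (Equiv.swap c i₀) * shearGL i₀ q hq0, fun a b ha hb => ?_⟩
    rw [map_mul, map_mul, Units.val_mul, Units.val_mul, ← Matrix.mul_assoc, ← Matrix.mul_assoc,
      ← hM', ← hM'', mul_shearGL_apply]
    rcases eq_or_ne a i₀ with rfl | hne
    · have : (q b : ℚ_[p]) = -(M'' i₀ b / M'' i₀ i₀) := if_pos hb
      rw [this]
      -- `M` need not be invertible: if the pivot vanishes, maximality makes the entries to its left
      -- vanish too.
      by_cases h0 : M'' i₀ i₀ = 0
      · have := hpiv b hb
        rw [h0, norm_zero, norm_le_zero_iff] at this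
        simp [this, h0]
      · field_simp
        ring
    · have ha' : i₀ < a := lt_of_le_of_ne (by rw [Fin.le_def]; exact ha) hne.symm
      rw [hlow a b ha' hb, hlow a i₀ ha' ha']
      simp

/-- The Iwasawa decomposition of `GL_n(ℚ_p)`. -/
theorem exists_eq_triangular_mul_integralGL (g : GL (Fin n) ℚ_[p]) :
    ∃ (T : Matrix (Fin n) (Fin n) ℚ_[p]) (V : GL (Fin n) ℤ_[p]), (∀ a b, b < a → T a b = 0) ∧
      (g : Matrix (Fin n) (Fin n) ℚ_[p]) = T * (integralGL p n V : Matrix (Fin n) (Fin n) ℚ_[p]) := by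
  obtain ⟨V, hV⟩ := exists_mul_integralGL_triangular_aux (g : Matrix (Fin n) (Fin n) ℚ_[p]) n le_rfl
  refine ⟨_, V⁻¹, fun a b hab => hV a b (by simp) hab, ?_⟩
  rw [Matrix.mul_assoc, integralGL_mul_inv, Matrix.mul_one]

theorem triangular_mul_submatrix_lastRow {T B : Matrix (Fin n) (Fin n) ℚ_[p]}
    (hT : ∀ a b, b < a → T a b = 0) (i : ℕ) :
    (T * B).submatrix (lastRow n i) id
      = T.submatrix (lastRow n i) (lastRow n i) * B.submatrix (lastRow n i) id := by
  ext r c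
  simp only [Matrix.submatrix_apply, Matrix.mul_apply, id]
  rw [← Finset.sum_image (f := fun x => T (lastRow n i r) x * B x c) (s := Finset.univ)
    (lastRow_injective n i).injOn, image_lastRow]
  refine (Finset.sum_subset (Finset.subset_univ _) fun x _ hx => ?_).symm
  rw [hT, zero_mul]
  simp only [Finset.mem_filter, Finset.mem_univ, true_and, not_le] at hx
  rw [Fin.lt_def]
  exact hx.trans_le (Nat.le_add_right _ _)

theorem det_triangular_submatrix {T : Matrix (Fin n) (Fin n) ℚ_[p]} (hT : ∀ a b, b < a → T a b = 0)
    {r : ℕ} (κ : Fin r → Fin n) (hκ : StrictMono κ) :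
    (T.submatrix κ κ).det = ∏ a, T (κ a) (κ a) := by
  refine Matrix.det_of_isUpperTriangular fun a b hab => ?_
  exact hT _ _ (hκ hab)

theorem cornerWeight_integralGL (V : GL (Fin n) ℤ_[p]) (i : ℕ) :
    cornerWeight (integralGL p n V) i = 0 := by
  have h := minorNorm_corner (integralGL p n V) i
  have h1 : corner (integralGL p n V) i
      = corner (1 : GL (Fin n) ℚ_[p]) i * (integralGL p n V : Matrix (Fin n) (Fin n) ℚ_[p]) := by
    rw [← corner_mul_coe, one_mul]
  have h2 : corner (1 : GL (Fin n) ℚ_[p]) i = (powDiagonal p n fun _ : Fin n => 0).submatrix (lastRow n i) id := by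
    ext a b
    simp [corner, powDiagonal, lastRow, Matrix.one_apply, Fin.ext_iff]
  have h3 : minorNorm (corner (1 : GL (Fin n) ℚ_[p]) i) = 1 := by
    rw [h2]
    refine le_antisymm (minorNorm_le zero_le_one fun J => ?_) ?_
    · simpa using norm_det_powDiagonal_submatrix_le (p := p) (fun _ : Fin n => 0) (lastRow n i) J
    · have := norm_det_powDiagonal_submatrix_eq (p := p) (fun _ : Fin n => 0) (lastRow n i)
        (lastRow_injective n i) (lastRow n i) fun _ => rfl
      simp only [Finset.sum_const_zero, neg_zero, zpow_zero] at this
      rw [← this]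
      exact norm_det_le_minorNorm
        ((powDiagonal p n fun _ : Fin n => 0).submatrix (lastRow n i) id) _
  rw [h1, minorNorm_mul_integralGL, h3] at h
  have := zpow_right_injective₀ natCast_prime_pos one_lt_natCast_prime.ne' ((zpow_zero (p : ℝ)).trans h)
  linarith

/-- The weights of the corners form a cocycle over the action on flags. -/
theorem exists_cornerWeight_mul (g : GL (Fin n) ℚ_[p]) :
    ∃ V : GL (Fin n) ℤ_[p], ∀ (h : GL (Fin n) ℚ_[p]) (i : ℕ),
      cornerWeight (g * h) i = cornerWeight g i + cornerWeight (integralGL p n V * h) i := by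
  obtain ⟨T, V, hT, hg⟩ := exists_eq_triangular_mul_integralGL g
  refine ⟨V, fun h i => ?_⟩
  have key : ∀ h : GL (Fin n) ℚ_[p], (p : ℝ) ^ (-cornerWeight (g * h) i)
      = ‖(T.submatrix (lastRow n i) (lastRow n i)).det‖ *
        (p : ℝ) ^ (-cornerWeight (integralGL p n V * h) i) := by
    intro h
    rw [← minorNorm_corner, ← minorNorm_corner, corner_eq_submatrix, Units.val_mul, hg,
      Matrix.mul_assoc, triangular_mul_submatrix_lastRow hT, minorNorm_mul_left]
    rfl
  -- Taking h = 1 identifies the determinant of the lower right block of `T` with the weight of `g`.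
  have h1 := key 1
  rw [mul_one, mul_one, cornerWeight_integralGL, neg_zero, zpow_zero, mul_one] at h1
  have h2 := key h
  rw [← h1, ← zpow_add₀ natCast_prime_pos.ne'] at h2
  have := zpow_right_injective₀ natCast_prime_pos one_lt_natCast_prime.ne' h2
  linarith

theorem norm_det_lastRow_eq {T : Matrix (Fin n) (Fin n) ℚ_[p]}
    {V : GL (Fin n) ℤ_[p]} {g : GL (Fin n) ℚ_[p]} (hT : ∀ a b, b < a → T a b = 0)
    (hg : (g : Matrix (Fin n) (Fin n) ℚ_[p])
      = T * (integralGL p n V : Matrix (Fin n) (Fin n) ℚ_[p])) (i : ℕ) :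
    (p : ℝ) ^ (-cornerWeight g i) = ‖(T.submatrix (lastRow n i) (lastRow n i)).det‖ := by
  rw [← minorNorm_corner, corner_eq_submatrix, hg, triangular_mul_submatrix_lastRow hT,
    minorNorm_mul_left, ← corner_eq_submatrix, minorNorm_corner, cornerWeight_integralGL]
  simp

theorem norm_prod_eq_zpow {ι : Type*} {s : Finset ι} {x : ι → ℚ_[p]} (h : ∀ a ∈ s, x a ≠ 0) :
    ‖∏ a ∈ s, x a‖ = (p : ℝ) ^ (-∑ a ∈ s, (x a).valuation) := by
  rw [← norm_prod_zpow, norm_prod, norm_prod]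
  refine Finset.prod_congr rfl fun a ha => ?_
  rw [Padic.norm_p_zpow, Padic.norm_eq_zpow_neg_valuation (h a ha)]

theorem triangular_diag_ne_zero {T : Matrix (Fin n) (Fin n) ℚ_[p]}
    {V : GL (Fin n) ℤ_[p]} {g : GL (Fin n) ℚ_[p]} (hT : ∀ a b, b < a → T a b = 0)
    (hg : (g : Matrix (Fin n) (Fin n) ℚ_[p])
      = T * (integralGL p n V : Matrix (Fin n) (Fin n) ℚ_[p])) (a : Fin n) : T a a ≠ 0 := by
  have h := norm_det_lastRow_eq hT hg 0
  rw [det_triangular_submatrix hT _ (lastRow_strictMono n 0), norm_prod] at h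
  intro h0
  have ha : lastRow n 0 a = a := Fin.ext (by simp [lastRow])
  exact (zpow_pos natCast_prime_pos _).ne' (h.trans
    (Finset.prod_eq_zero (Finset.mem_univ (a : Fin (n - 0))) (by rw [ha, h0, norm_zero])))

/-- The last rows of TV are the lower right block of T times the last rows of V, and the corner of
an integral V has weight 0. -/
theorem cornerWeight_eq_tailSum_valuation {T : Matrix (Fin n) (Fin n) ℚ_[p]}
    {V : GL (Fin n) ℤ_[p]} {g : GL (Fin n) ℚ_[p]} (hT : ∀ a b, b < a → T a b = 0)
    (hg : (g : Matrix (Fin n) (Fin n) ℚ_[p])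
      = T * (integralGL p n V : Matrix (Fin n) (Fin n) ℚ_[p])) (i : ℕ) :
    cornerWeight g i = tailSum (fun a => (T a a).valuation) i := by
  have h := norm_det_lastRow_eq hT hg i
  rw [det_triangular_submatrix hT _ (lastRow_strictMono n i),
    norm_prod_eq_zpow fun a _ => triangular_diag_ne_zero hT hg _] at h
  have := zpow_right_injective₀ natCast_prime_pos one_lt_natCast_prime.ne' h
  rw [tailSum]
  linarith

/-- Upper bound for a corner weight in terms of one minor of the rows selected by `σ`. -/
theorem zpow_cornerWeight_permGL_ge {T : Matrix (Fin n) (Fin n) ℚ_[p]}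
    {V : GL (Fin n) ℤ_[p]} {g : GL (Fin n) ℚ_[p]}
    (hg : (g : Matrix (Fin n) (Fin n) ℚ_[p])
      = T * (integralGL p n V : Matrix (Fin n) (Fin n) ℚ_[p])) (σ : Equiv.Perm (Fin n)) (i : ℕ)
    (J : Fin (n - i) → Fin n) :
    ‖(T.submatrix (σ ∘ lastRow n i) J).det‖
      ≤ (p : ℝ) ^ (-cornerWeight (integralGL p n (permGL p σ) * g) i) := by
  rw [← minorNorm_corner, corner_permGL_mul, hg]
  have : (T * (integralGL p n V : Matrix (Fin n) (Fin n) ℚ_[p])).submatrix (σ ∘ lastRow n i) id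
      = T.submatrix (σ ∘ lastRow n i) id * (integralGL p n V : Matrix (Fin n) (Fin n) ℚ_[p]) := by
    ext a b
    simp [Matrix.mul_apply]
  rw [this, minorNorm_mul_integralGL]
  exact norm_det_le_minorNorm (T.submatrix (σ ∘ lastRow n i) id) J

/-- Swapping the rows `i` and `i + 1`. -/
def adjSwap (i : ℕ) (hi : i + 1 < n) : Equiv.Perm (Fin n) :=
  Equiv.swap ⟨i, by omega⟩ ⟨i + 1, hi⟩

theorem adjSwap_lastRow_zero (i : ℕ) (hi : i + 1 < n) {r : Fin (n - (i + 1))} (hr : r.val = 0) :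
    adjSwap i hi (lastRow n (i + 1) r) = ⟨i, by omega⟩ := by
  have : lastRow n (i + 1) r = ⟨i + 1, hi⟩ := Fin.ext (by simp [lastRow, hr])
  rw [this, adjSwap, Equiv.swap_apply_right]

theorem adjSwap_lastRow_pos (i : ℕ) (hi : i + 1 < n) {r : Fin (n - (i + 1))} (hr : r.val ≠ 0) :
    adjSwap i hi (lastRow n (i + 1) r) = lastRow n (i + 1) r := by
  refine Equiv.swap_apply_of_ne_of_ne ?_ ?_ <;>
  · intro h
    have := congrArg Fin.val h
    simp only [lastRow] at this
    omega

theorem tailSum_adjSwap (l : Fin n → ℤ) (i : ℕ) (hi : i + 1 < n) :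
    ∑ r, l (adjSwap i hi (lastRow n (i + 1) r)) = l ⟨i, by omega⟩ + tailSum l (i + 2) := by
  have h := tailSum_eq_add (fun a => l (adjSwap i hi a)) ⟨i + 1, hi⟩
  rw [tailSum] at h
  simp only at h
  rw [h, adjSwap, Equiv.swap_apply_right]
  congr 1
  refine Finset.sum_congr rfl fun r _ => ?_
  change l (Equiv.swap _ _ (lastRow n (i + 2) r)) = _
  rw [Equiv.swap_apply_of_ne_of_ne] <;>
  · intro h
    have := congrArg Fin.val h
    simp only [lastRow] at this
    omega

/-- Let d_a be the valuation of T_aa. Then w_i + w_{i+2} - w_{i+1} equals d_i + d_{i+2} + … +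
d_{n-1}, the valuation of the principal minor of T on the indices i, i+2, …, n-1. These are the rows
of the swapped corner, so this minor bounds its weight from above. -/
theorem cornerWeight_supermodular (g : GL (Fin n) ℚ_[p]) (i : ℕ) (hi : i + 1 < n) :
    cornerWeight g (i + 1) + cornerWeight (integralGL p n (permGL p (adjSwap i hi)) * g) (i + 1)
      ≤ cornerWeight g i + cornerWeight g (i + 2) := by
  obtain ⟨T, V, hT, hg⟩ := exists_eq_triangular_mul_integralGL g
  have h := zpow_cornerWeight_permGL_ge hg (adjSwap i hi) (i + 1)
    (adjSwap i hi ∘ lastRow n (i + 1))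
  have hmono : StrictMono (adjSwap i hi ∘ lastRow n (i + 1)) := by
    intro a b hab
    have hb : b.val ≠ 0 := by
      rw [Fin.lt_def] at hab
      omega
    rw [Function.comp_apply, Function.comp_apply, adjSwap_lastRow_pos i hi hb]
    by_cases ha : a.val = 0
    · rw [adjSwap_lastRow_zero i hi ha, Fin.lt_def]
      simp only [lastRow]
      omega
    · rw [adjSwap_lastRow_pos i hi ha]
      exact lastRow_strictMono _ _ hab
  rw [det_triangular_submatrix hT _ hmono,
    norm_prod_eq_zpow fun a _ => triangular_diag_ne_zero hT hg _,
    zpow_le_zpow_iff_right₀ one_lt_natCast_prime, neg_le_neg_iff] at h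
  have h3 := tailSum_adjSwap (fun a => (T a a).valuation) i hi
  simp only [Function.comp_apply] at h
  rw [h3] at h
  rw [cornerWeight_eq_tailSum_valuation hT hg, cornerWeight_eq_tailSum_valuation hT hg,
    cornerWeight_eq_tailSum_valuation hT hg]
  have h1 := tailSum_eq_add (fun a => (T a a).valuation) ⟨i, by omega⟩
  have h2 := tailSum_eq_add (fun a => (T a a).valuation) ⟨i + 1, hi⟩
  simp only at h1 h2
  linarith

/-- For a matrix with distinct singular numbers, the inequality `cornerWeight_supermodular`
is strict after a suitable change of rows. -/
theorem exists_cornerWeight_supermodular_strict (g : GL (Fin n) ℚ_[p]) (i : ℕ) (hi : i + 1 < n)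
    (hg : ¬ ∃ M : ℤ, ∀ j, SN (g : Matrix (Fin n) (Fin n) ℚ_[p]) j = M) :
    ∃ U : GL (Fin n) ℤ_[p],
      cornerWeight (integralGL p n U * g) (i + 1)
        + cornerWeight (integralGL p n (permGL p (adjSwap i hi)) * (integralGL p n U * g)) (i + 1)
      < cornerWeight (integralGL p n U * g) i + cornerWeight (integralGL p n U * g) (i + 2) := by
  have hsn := isSingularNumbers_SN_GL g
  set l := SN (g : Matrix (Fin n) (Fin n) ℚ_[p])
  obtain ⟨a, b, hab⟩ : ∃ a b : Fin n, l b < l a := by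
    by_contra! h
    exact hg ⟨l ⟨0, by omega⟩, fun j => le_antisymm (h _ _) (h _ _)⟩
  obtain ⟨-, U₀, V₀, hUV⟩ := hsn
  have hij : (⟨i, by omega⟩ : Fin n) ≠ ⟨i + 1, hi⟩ := by simp
  -- Reorder the diagonal form so that the larger singular number l_a stands at i and the smaller
  -- l_b at i + 1.
  obtain ⟨π, hπ⟩ := Equiv.Perm.exists_extending_pair ![(⟨i, by omega⟩ : Fin n), ⟨i + 1, hi⟩]
    ![a, b] (by
      intro x y
      fin_cases x <;> fin_cases y <;> simp) (by
      have : a ≠ b := fun h => hab.ne (by rw [h])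
      intro x y
      fin_cases x <;> fin_cases y <;> simp [this, this.symm])
  have hπa : π ⟨i, by omega⟩ = a := hπ 0
  have hπb : π ⟨i + 1, hi⟩ = b := hπ 1
  let l' : Fin n → ℤ := l ∘ π
  let q : Fin n → ℤ_[p] := fun c => if c = ⟨i + 1, hi⟩ then 1 else 0
  have hq : q ⟨i, by omega⟩ = 0 := if_neg hij
  -- Adding row i + 1 to row i keeps the matrix triangular with the same diagonal, but puts the
  -- entry p ^ l_b into row i, column i + 1.
  let E := shearGL (⟨i, by omega⟩ : Fin n) q hq
  let T : Matrix (Fin n) (Fin n) ℚ_[p] :=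
    (integralGL p n E : Matrix (Fin n) (Fin n) ℚ_[p]) * powDiagonal p n l'
  have hTa : ∀ c d, T c d = powDiagonal p n l' c d +
      if c = ⟨i, by omega⟩ then powDiagonal p n l' ⟨i + 1, hi⟩ d else 0 := by
    intro c d
    refine (shearGL_mul_apply (powDiagonal p n l') _ q hq c d).trans ?_
    congr 1
    split_ifs with h
    · rw [Finset.sum_eq_single ⟨i + 1, hi⟩]
      · simp [q]
      · intro x _ hx
        simp [q, hx]
      · simp
    · rfl
  have hT : ∀ c d, d < c → T c d = 0 := by
    intro c d hdc
    rw [Fin.lt_def] at hdc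
    rw [hTa]
    simp only [powDiagonal, Matrix.of_apply]
    rw [if_neg (by omega)]
    split_ifs with h1 h2
    · rw [h1] at hdc
      simp only at hdc
      omega
    · simp
    · simp
  have hTd : ∀ c, (T c c).valuation = l' c := by
    intro c
    rw [hTa]
    simp only [powDiagonal, Matrix.of_apply, if_true]
    have : (if c = ⟨i, by omega⟩ then if i + 1 = c.val then (p : ℚ_[p]) ^ l' ⟨i + 1, hi⟩ else 0
        else (0 : ℚ_[p])) = 0 := by
      split_ifs with h1 h2
      · rw [h1] at h2
        simp at h2
      · rfl
      · rfl
    rw [this, add_zero, Padic.valuation_zpow, Padic.valuation_p, mul_one]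
  have hU0 : (integralGL p n U₀⁻¹ : Matrix (Fin n) (Fin n) ℚ_[p])
      * (integralGL p n U₀ : Matrix (Fin n) (Fin n) ℚ_[p]) = 1 := by
    rw [← Units.val_mul, ← map_mul, inv_mul_cancel, map_one, Units.val_one]
  have hh : ((integralGL p n (E * permGL p π * U₀⁻¹) * g : GL (Fin n) ℚ_[p]) :
      Matrix (Fin n) (Fin n) ℚ_[p])
      = T * (integralGL p n (permGL p π * V₀) : Matrix (Fin n) (Fin n) ℚ_[p]) := by
    simp only [map_mul, Units.val_mul, T]
    rw [hUV]
    have hD : (integralGL p n (permGL p π) : Matrix (Fin n) (Fin n) ℚ_[p]) * powDiagonal p n l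
        = powDiagonal p n l' * (integralGL p n (permGL p π) : Matrix (Fin n) (Fin n) ℚ_[p]) := by
      rw [permGL_mul, mul_permGL]
      ext c d
      simp [powDiagonal, l', ← Fin.ext_iff, Equiv.eq_symm_apply]
    calc _ = (integralGL p n E : Matrix (Fin n) (Fin n) ℚ_[p]) *
          ((integralGL p n (permGL p π) : Matrix (Fin n) (Fin n) ℚ_[p]) *
          (((integralGL p n U₀⁻¹ : Matrix (Fin n) (Fin n) ℚ_[p])
          * (integralGL p n U₀ : Matrix (Fin n) (Fin n) ℚ_[p])) * powDiagonal p n l)) *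
          (integralGL p n V₀ : Matrix (Fin n) (Fin n) ℚ_[p]) := by
          simp only [Matrix.mul_assoc]
      _ = _ := by
        rw [hU0, Matrix.one_mul, hD]
        simp only [Matrix.mul_assoc]
  refine ⟨E * permGL p π * U₀⁻¹, ?_⟩
  -- The minor of rows i, i+2, … and columns i+1, i+2, … uses p ^ l_b instead of p ^ l_a; since l_b
  -- < l_a it beats the principal minor behind `cornerWeight_supermodular`.
  have h := zpow_cornerWeight_permGL_ge hh (adjSwap i hi) (i + 1) (lastRow n (i + 1))
  have hsub : T.submatrix (adjSwap i hi ∘ lastRow n (i + 1)) (lastRow n (i + 1))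
      = (powDiagonal p n l').submatrix (lastRow n (i + 1)) (lastRow n (i + 1)) := by
    ext r s
    rw [Matrix.submatrix_apply, Matrix.submatrix_apply, hTa, Function.comp_apply]
    by_cases hr : r.val = 0
    · have hr' : lastRow n (i + 1) r = ⟨i + 1, hi⟩ := Fin.ext (by simp [lastRow, hr])
      rw [adjSwap_lastRow_zero i hi hr, if_pos rfl, hr']
      have : powDiagonal p n l' ⟨i, by omega⟩ (lastRow n (i + 1) s) = 0 := by
        simp only [powDiagonal, Matrix.of_apply, lastRow]
        rw [if_neg (by omega)]
      rw [this, zero_add]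
    · rw [adjSwap_lastRow_pos i hi hr, if_neg, add_zero]
      intro h
      have := congrArg Fin.val h
      simp only [lastRow] at this
      omega
  rw [hsub, norm_det_powDiagonal_submatrix_eq l' _ (lastRow_injective _ _) _ fun _ => rfl,
    zpow_le_zpow_iff_right₀ one_lt_natCast_prime, neg_le_neg_iff] at h
  rw [cornerWeight_eq_tailSum_valuation hT hh, cornerWeight_eq_tailSum_valuation hT hh,
    cornerWeight_eq_tailSum_valuation hT hh]
  simp only [hTd]
  have h1 := tailSum_eq_add l' ⟨i, by omega⟩
  have h2 := tailSum_eq_add l' ⟨i + 1, hi⟩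
  have h3 : l' ⟨i, by omega⟩ = l a := by simp [l', hπa]
  have h4 : l' ⟨i + 1, hi⟩ = l b := by simp [l', hπb]
  have h5 : tailSum l' (i + 1) = ∑ r, l' (lastRow n (i + 1) r) := rfl
  simp only at h1 h2
  change tailSum l' (i + 1) + _ < tailSum l' i + tailSum l' (i + 2)
  rw [← h5] at h
  linarith

end Triangular

/-! ### Strict ordering of the expected increments -/

section Invariance

variable {p : ℕ} [Fact p.Prime] {n : ℕ}

instance secondCountableTopology_GL : SecondCountableTopology (GL (Fin n) ℚ_[p]) := by
  have h1 : SecondCountableTopology (Matrix (Fin n) (Fin n) ℚ_[p]) :=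
    inferInstanceAs (SecondCountableTopology (Fin n → Fin n → ℚ_[p]))
  have h2 : SecondCountableTopology (Matrix (Fin n) (Fin n) ℚ_[p])ᵐᵒᵖ :=
    MulOpposite.opHomeomorph.symm.isEmbedding.secondCountableTopology
  exact Units.isEmbedding_embedProduct.secondCountableTopology

instance measurableMul₂_GL : MeasurableMul₂ (GL (Fin n) ℚ_[p]) := ContinuousMul.measurableMul₂

theorem measurable_cornerWeight (i : ℕ) :
    Measurable fun g : GL (Fin n) ℚ_[p] => (cornerWeight g i : ℝ) :=
  (continuous_cornerWeight i).measurable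

theorem IsBiInvariant.map_mul_left {ν : Measure (GL (Fin n) ℚ_[p])} (hν : IsBiInvariant ν)
    (U : GL (Fin n) ℤ_[p]) : ν.map (fun g => integralGL p n U * g) = ν := by
  simpa using hν U 1

theorem IsBiInvariant.identDistrib {ν : Measure (GL (Fin n) ℚ_[p])} (hν : IsBiInvariant ν)
    (U : GL (Fin n) ℤ_[p]) : IdentDistrib (fun g => integralGL p n U * g) id ν ν :=
  ⟨(measurable_const_mul _).aemeasurable, aemeasurable_id, by
    rw [hν.map_mul_left, Measure.map_id]⟩

theorem IsBiInvariant.identDistrib_cornerWeight {ν : Measure (GL (Fin n) ℚ_[p])}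
    (hν : IsBiInvariant ν) (U : GL (Fin n) ℤ_[p]) (i : ℕ) :
    IdentDistrib (fun g => (cornerWeight (integralGL p n U * g) i : ℝ))
      (fun g => (cornerWeight g i : ℝ)) ν ν :=
  (hν.identDistrib U).comp (measurable_cornerWeight i)

/-- The expected increments of the corner weights are strictly ordered. -/
theorem IsBiInvariant.integral_cornerWeight_lt {ν : Measure (GL (Fin n) ℚ_[p])}
    (hν : IsBiInvariant ν) (hint : ∀ i, Integrable (fun g => (cornerWeight g i : ℝ)) ν)
    (hnc : ¬ ∀ᵐ g : GL (Fin n) ℚ_[p] ∂ν, ∃ M : ℤ, ∀ i, SN (g : Matrix (Fin n) (Fin n) ℚ_[p]) i = M) (i : ℕ)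
    (hi : i + 1 < n) :
    (∫ g, (cornerWeight g (i + 1) : ℝ) ∂ν) - ∫ g, (cornerWeight g (i + 2) : ℝ) ∂ν
      < (∫ g, (cornerWeight g i : ℝ) ∂ν) - ∫ g, (cornerWeight g (i + 1) : ℝ) ∂ν := by
  set s := integralGL p n (permGL p (adjSwap i hi))
  -- The gap in the supermodular inequality; by invariance its integral is the difference of the two
  -- expected increments.
  let f : GL (Fin n) ℚ_[p] → ℝ := fun g => ((cornerWeight g i : ℝ) + cornerWeight g (i + 2))
    - ((cornerWeight g (i + 1) : ℝ) + cornerWeight (s * g) (i + 1))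
  have hs := hν.identDistrib_cornerWeight (permGL p (adjSwap i hi)) (i + 1)
  have hsint : Integrable (fun g => (cornerWeight (s * g) (i + 1) : ℝ)) ν :=
    hs.integrable_iff.2 (hint _)
  have hf0 : ∀ g, 0 ≤ f g := fun g => sub_nonneg.2 (by
    exact_mod_cast cornerWeight_supermodular g i hi)
  have hfint : Integrable f ν := ((hint _).add (hint _)).sub ((hint _).add hsint)
  have hfi : ∫ g, f g ∂ν = ((∫ g, (cornerWeight g i : ℝ) ∂ν) + ∫ g, (cornerWeight g (i + 2) : ℝ) ∂ν)
      - ((∫ g, (cornerWeight g (i + 1) : ℝ) ∂ν) + ∫ g, (cornerWeight g (i + 1) : ℝ) ∂ν) := by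
    refine (integral_sub ((hint _).add (hint _)) ((hint _).add hsint)).trans ?_
    refine congrArg₂ _ (integral_add (hint _) (hint _)) ((integral_add (hint _) hsint).trans ?_)
    rw [hs.integral_eq]
  have hpos : 0 < ∫ g, f g ∂ν := by
    refine lt_of_le_of_ne (integral_nonneg hf0) fun h => hnc ?_
    have hae : f =ᵐ[ν] 0 := (integral_eq_zero_iff_of_nonneg hf0 hfint).1 h.symm
    have hcont : Continuous f :=
      ((continuous_cornerWeight i).add (continuous_cornerWeight (i + 2))).sub
        ((continuous_cornerWeight (i + 1)).add
          ((continuous_cornerWeight (i + 1)).comp (continuous_const_mul s)))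
    -- The translate making the inequality strict depends on g. The sets for each U are open, so
    -- second countability replaces this union over all of GL_n(ℤ_p) by a countable one.
    obtain ⟨S, hS, hSU⟩ := TopologicalSpace.isOpen_iUnion_countable
      (fun U : GL (Fin n) ℤ_[p] => {g | 0 < f (integralGL p n U * g)})
      (fun U => isOpen_lt continuous_const (hcont.comp (continuous_const_mul _)))
    have hnull : ν (⋃ U : GL (Fin n) ℤ_[p], {g | 0 < f (integralGL p n U * g)}) = 0 := by
      rw [← hSU, measure_biUnion_null_iff hS]
      intro U _
      have h1 : ν.map (fun g => integralGL p n U * g) {g | 0 < f g} = 0 := by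
        rw [hν.map_mul_left]
        refine measure_mono_null (fun g hg => ?_) (ae_iff.1 hae)
        exact ne_of_gt hg
      rwa [Measure.map_apply (measurable_const_mul _)
        (isOpen_lt continuous_const hcont).measurableSet] at h1
    refine ae_iff.2 (measure_mono_null (fun g hg => ?_) hnull)
    obtain ⟨U, hU⟩ := exists_cornerWeight_supermodular_strict g i hi hg
    refine Set.mem_iUnion.2 ⟨U, ?_⟩
    have hU' := (Int.cast_lt (R := ℝ)).2 hU
    push_cast at hU'
    exact sub_pos.2 hU'
  rw [hfi] at hpos
  linarith

end Invariance

/-! ### Cocycles along the product as sums of independent increments -/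

section Walk

variable {p : ℕ} [Fact p.Prime] {n : ℕ}

theorem partialProd_zero (A : ℕ → GL (Fin n) ℚ_[p]) : partialProd A 0 = 1 := rfl

theorem partialProd_succ (A : ℕ → GL (Fin n) ℚ_[p]) (k : ℕ) :
    partialProd A (k + 1) = partialProd A k * A k := by
  simp [partialProd, List.range_succ]

theorem partialProd_congr {A B : ℕ → GL (Fin n) ℚ_[p]} {k : ℕ} (h : ∀ j < k, A j = B j) :
    partialProd A k = partialProd B k := by
  induction k with
  | zero => rfl
  | succ k ih =>
    rw [partialProd_succ, partialProd_succ, ih fun j hj => h j (by omega), h k (by omega)]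

theorem measurable_partialProd {S : Type*} [MeasurableSpace S] {A : ℕ → S → GL (Fin n) ℚ_[p]}
    (hA : ∀ j, Measurable (A j)) (k : ℕ) : Measurable fun s => partialProd (fun j => A j s) k := by
  induction k with
  | zero => exact measurable_const
  | succ k ih =>
    simp_rw [partialProd_succ]
    exact ih.mul (hA k)

/-- An additive functional of the action of `GL_n(ℚ_p)` on its flags. -/
def IsFlagCocycle {E : Type*} [Add E] (x : GL (Fin n) ℚ_[p] → E) : Prop :=
  ∀ g, ∃ V : GL (Fin n) ℤ_[p], ∀ h, x (g * h) = x g + x (integralGL p n V * h)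

/-- The increments of the walk `x (A_1 ⋯ A_k)`. -/
noncomputable def increment {Ω E : Type*} [AddCommGroup E] (x : GL (Fin n) ℚ_[p] → E) (A : ℕ → Ω → GL (Fin n) ℚ_[p]) (k : ℕ) (ω : Ω) : E :=
  x (partialProd (fun j => A j ω) (k + 1)) - x (partialProd (fun j => A j ω) k)

theorem walk_succ {Ω E : Type*} [AddCommGroup E] (x : GL (Fin n) ℚ_[p] → E) (A : ℕ → Ω → GL (Fin n) ℚ_[p]) (k : ℕ) (ω : Ω) :
    x (partialProd (fun j => A j ω) (k + 1))
      = x (partialProd (fun j => A j ω) k) + increment x A k ω := by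
  rw [increment, add_sub_cancel]

variable {Ω : Type*} [MeasurableSpace Ω] {P : Measure Ω} {A : ℕ → Ω → GL (Fin n) ℚ_[p]}

/-- The extension by `1` of a tuple of matrices to a sequence. -/
noncomputable def extendOne (k : ℕ) (a : Finset.range k → GL (Fin n) ℚ_[p]) (j : ℕ) : GL (Fin n) ℚ_[p] :=
  if h : j ∈ Finset.range k then a ⟨j, h⟩ else 1

theorem measurable_extendOne (k j : ℕ) :
    Measurable fun a : Finset.range k → GL (Fin n) ℚ_[p] => extendOne k a j := by
  unfold extendOne
  split_ifs
  · exact measurable_pi_apply _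
  · exact measurable_const

theorem partialProd_extendOne (A : ℕ → GL (Fin n) ℚ_[p]) {j k : ℕ} (hj : j ≤ k) :
    partialProd (extendOne k fun i => A i) j = partialProd A j :=
  partialProd_congr fun i hi => by
    rw [extendOne, dif_pos (Finset.mem_range.2 (by omega))]

theorem indepFun_prefix (hmeas : ∀ k, Measurable (A k)) (hindep : iIndepFun A P) (k : ℕ) :
    IndepFun (fun ω (j : Finset.range k) => A j ω) (A k) P := by
  have h := hindep.indepFun_finset (Finset.range k) {k} (by simp) hmeas
  exact h.comp measurable_id (measurable_pi_apply ⟨k, Finset.mem_singleton_self k⟩)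

theorem indepFun_partialProd (hmeas : ∀ k, Measurable (A k)) (hindep : iIndepFun A P) (k : ℕ) :
    IndepFun (fun ω => partialProd (fun j => A j ω) k) (A k) P := by
  have h := (indepFun_prefix hmeas hindep k).comp
    (measurable_partialProd (measurable_extendOne k) k) measurable_id
  convert h using 1
  · ext1 ω
    exact (partialProd_extendOne (fun j => A j ω) le_rfl).symm
  · rfl

variable {E : Type*} [AddCommGroup E] [MeasurableSpace E] [MeasurableSub₂ E]

theorem measurable_increment {x : GL (Fin n) ℚ_[p] → E} (hx : Measurable x)
    (hmeas : ∀ k, Measurable (A k)) (k : ℕ) : Measurable (increment x A k) :=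
  (hx.comp (measurable_partialProd hmeas _)).sub (hx.comp (measurable_partialProd hmeas _))

variable [IsProbabilityMeasure P]

/-- Given the first k matrices, the increment is x(V A_{k+1}) with V a function of them. By left
invariance its conditional law does not depend on V, so it is independent of the past. -/
theorem increment_aux {x : GL (Fin n) ℚ_[p] → E} (hx : Measurable x)
    (hcoc : IsFlagCocycle x) (hmeas : ∀ k, Measurable (A k)) (hindep : iIndepFun A P)
    (hident : ∀ k, IdentDistrib (A k) (A 0) P P) (hinv : IsBiInvariant (P.map (A 0))) (k : ℕ) :
    P.map (fun ω => ((fun j : Finset.range k => A j ω), increment x A k ω))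
      = (P.map fun ω (j : Finset.range k) => A j ω).prod ((P.map (A 0)).map x) := by
  set X : Ω → (Finset.range k → GL (Fin n) ℚ_[p]) := fun ω j => A j ω
  have hX : Measurable X := measurable_pi_lambda _ fun j => hmeas j
  have hφ : Measurable fun a : Finset.range k → GL (Fin n) ℚ_[p] => partialProd (extendOne k a) k :=
    measurable_partialProd (measurable_extendOne k) k
  have := Measure.isProbabilityMeasure_map (μ := P) (hmeas 0).aemeasurable
  have := Measure.isProbabilityMeasure_map (μ := P) hX.aemeasurable
  -- The skew product only asks for the law of the increment at each fixed prefix, so V need not be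
  -- chosen measurably.
  have hsk := (MeasurePreserving.id (P.map X)).skew_product (μc := P.map (A 0))
    (μd := (P.map (A 0)).map x)
    (g := fun a g => x (partialProd (extendOne k a) k * g) - x (partialProd (extendOne k a) k))
    ((hx.comp ((hφ.comp measurable_fst).mul measurable_snd)).sub
      (hx.comp (hφ.comp measurable_fst))) (ae_of_all _ fun a => by
        obtain ⟨V, hV⟩ := hcoc (partialProd (extendOne k a) k)
        simp_rw [hV, add_sub_cancel_left]
        conv_rhs => rw [← hinv.map_mul_left V]
        rw [Measure.map_map hx (measurable_const_mul _)]
        rfl)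
  have hind := (indepFun_iff_map_prod_eq_prod_map_map hX.aemeasurable (hmeas k).aemeasurable).1
    (indepFun_prefix hmeas hindep k)
  rw [(hident k).map_eq] at hind
  have h := hsk.map_eq
  rw [← hind, Measure.map_map hsk.measurable (hX.prodMk (hmeas k))] at h
  rw [← h]
  congr 1
  ext1 ω
  simp only [Function.comp_apply, id, X]
  rw [partialProd_extendOne (fun j => A j ω) le_rfl, ← partialProd_succ (fun j => A j ω)]
  rfl

theorem map_increment {x : GL (Fin n) ℚ_[p] → E} (hx : Measurable x)
    (hcoc : IsFlagCocycle x) (hmeas : ∀ k, Measurable (A k)) (hindep : iIndepFun A P)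
    (hident : ∀ k, IdentDistrib (A k) (A 0) P P) (hinv : IsBiInvariant (P.map (A 0))) (k : ℕ) :
    P.map (increment x A k) = (P.map (A 0)).map x := by
  have h := increment_aux hx hcoc hmeas hindep hident hinv k
  have hX : Measurable fun ω (j : Finset.range k) => A j ω :=
    measurable_pi_lambda _ fun j => hmeas j
  have := Measure.isProbabilityMeasure_map (μ := P) hX.aemeasurable
  have := Measure.isProbabilityMeasure_map (μ := P) (hmeas 0).aemeasurable
  have := Measure.isProbabilityMeasure_map (μ := P.map (A 0)) hx.aemeasurable
  have h1 := congrArg (Measure.map Prod.snd) h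
  rw [Measure.map_snd_prod, measure_univ, one_smul,
    Measure.map_map measurable_snd (hX.prodMk (measurable_increment hx hmeas k))] at h1
  exact h1

theorem identDistrib_increment {x : GL (Fin n) ℚ_[p] → E} (hx : Measurable x)
    (hcoc : IsFlagCocycle x) (hmeas : ∀ k, Measurable (A k)) (hindep : iIndepFun A P)
    (hident : ∀ k, IdentDistrib (A k) (A 0) P P) (hinv : IsBiInvariant (P.map (A 0))) (k : ℕ) :
    IdentDistrib (increment x A k) (fun ω => x (A 0 ω)) P P :=
  ⟨(measurable_increment hx hmeas k).aemeasurable, (hx.comp (hmeas 0)).aemeasurable, by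
    rw [map_increment hx hcoc hmeas hindep hident hinv, Measure.map_map hx (hmeas 0)]
    rfl⟩

theorem indepFun_prefix_increment {x : GL (Fin n) ℚ_[p] → E} (hx : Measurable x)
    (hcoc : IsFlagCocycle x) (hmeas : ∀ k, Measurable (A k)) (hindep : iIndepFun A P)
    (hident : ∀ k, IdentDistrib (A k) (A 0) P P) (hinv : IsBiInvariant (P.map (A 0))) (k : ℕ) :
    IndepFun (fun ω (j : Finset.range k) => A j ω) (increment x A k) P := by
  have hX : Measurable fun ω (j : Finset.range k) => A j ω :=
    measurable_pi_lambda _ fun j => hmeas j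
  rw [indepFun_iff_map_prod_eq_prod_map_map hX.aemeasurable
    (measurable_increment hx hmeas k).aemeasurable,
    increment_aux hx hcoc hmeas hindep hident hinv,
    map_increment hx hcoc hmeas hindep hident hinv]

/-- The earlier of two increments is a function of the prefix from which the later one is
independent. Pairwise independence is enough for the strong law. -/
theorem pairwise_indepFun_increment {x : GL (Fin n) ℚ_[p] → E} (hx : Measurable x)
    (hcoc : IsFlagCocycle x) (hmeas : ∀ k, Measurable (A k)) (hindep : iIndepFun A P)
    (hident : ∀ k, IdentDistrib (A k) (A 0) P P) (hinv : IsBiInvariant (P.map (A 0))) :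
    Pairwise fun j k => IndepFun (increment x A j) (increment x A k) P := by
  have key : ∀ j k, j < k → IndepFun (increment x A j) (increment x A k) P := by
    intro j k hjk
    have h := (indepFun_prefix_increment hx hcoc hmeas hindep hident hinv k).comp
      (measurable_increment (A := fun j a => extendOne k a j) hx (measurable_extendOne k) j)
      measurable_id
    convert h using 1
    · ext1 ω
      simp only [increment, Function.comp_apply]
      rw [partialProd_extendOne (fun j => A j ω) (by omega),
        partialProd_extendOne (fun j => A j ω) (by omega)]
    · rfl
  intro j k hjk
  rcases lt_or_gt_of_ne hjk with h | h
  · exact key j k h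
  · exact (key k j h).symm

theorem indepFun_walk_increment {x : GL (Fin n) ℚ_[p] → E} (hx : Measurable x)
    (hcoc : IsFlagCocycle x) (hmeas : ∀ k, Measurable (A k)) (hindep : iIndepFun A P)
    (hident : ∀ k, IdentDistrib (A k) (A 0) P P) (hinv : IsBiInvariant (P.map (A 0))) (k : ℕ) :
    IndepFun (fun ω => x (partialProd (fun j => A j ω) k)) (increment x A k) P := by
  have h := (indepFun_prefix_increment hx hcoc hmeas hindep hident hinv k).comp
    (hx.comp (measurable_partialProd (measurable_extendOne k) k)) measurable_id
  convert h using 1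
  · ext1 ω
    simp only [Function.comp_apply]
    rw [partialProd_extendOne (fun j => A j ω) le_rfl]
  · rfl

/-- The walk `x (A_1 ⋯ A_k)` has the same law as the sum of the `x (A_j)`. -/
theorem identDistrib_walk_sum [MeasurableAdd₂ E] {x : GL (Fin n) ℚ_[p] → E} (hx : Measurable x)
    (hcoc : IsFlagCocycle x) (hx1 : x 1 = 0) (hmeas : ∀ k, Measurable (A k))
    (hindep : iIndepFun A P) (hident : ∀ k, IdentDistrib (A k) (A 0) P P)
    (hinv : IsBiInvariant (P.map (A 0))) (k : ℕ) :
    IdentDistrib (fun ω => x (partialProd (fun j => A j ω) k))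
      (fun ω => ∑ j ∈ Finset.range k, x (A j ω)) P P := by
  induction k with
  | zero => simpa [partialProd_zero, hx1] using IdentDistrib.refl measurable_const.aemeasurable
  | succ k ih =>
    have hX : iIndepFun (fun j ω => x (A j ω)) P := hindep.comp (fun _ => x) fun _ => hx
    have hsum : IndepFun (fun ω => ∑ j ∈ Finset.range k, x (A j ω)) (fun ω => x (A k ω)) P := by
      have := hX.indepFun_finsetSum_of_notMem (fun j => hx.comp (hmeas j))
        (s := Finset.range k) (i := k) (by simp)
      convert this using 1
      ext1 ω
      simp
    have hinc := (identDistrib_increment hx hcoc hmeas hindep hident hinv k).trans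
      ((hident k).comp hx).symm
    have h := (ih.prodMk hinc (indepFun_walk_increment hx hcoc hmeas hindep hident hinv k) hsum).comp
      measurable_add
    convert h using 1
    · ext1 ω
      exact walk_succ x A k ω
    · ext1 ω
      exact Finset.sum_range_succ _ _

/-- Strong law of large numbers for additive functionals of the walk. -/
theorem strong_law_walk {x : GL (Fin n) ℚ_[p] → ℝ} (hx : Measurable x)
    (hcoc : IsFlagCocycle x) (hx1 : x 1 = 0) (hmeas : ∀ k, Measurable (A k))
    (hindep : iIndepFun A P) (hident : ∀ k, IdentDistrib (A k) (A 0) P P)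
    (hinv : IsBiInvariant (P.map (A 0))) (hint : Integrable (fun ω => x (A 0 ω)) P) :
    ∀ᵐ ω ∂P, Tendsto (fun k : ℕ => x (partialProd (fun j => A j ω) k) / k) atTop
      (𝓝 (∫ ω, x (A 0 ω) ∂P)) := by
  have hi := identDistrib_increment hx hcoc hmeas hindep hident hinv
  have h := strong_law_ae_real (increment x A) ((hi 0).integrable_iff.2 hint)
    (pairwise_indepFun_increment hx hcoc hmeas hindep hident hinv)
    fun k => (hi k).trans (hi 0).symm
  rw [(hi 0).integral_eq] at h
  filter_upwards [h] with ω hω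
  refine hω.congr fun k => ?_
  congr 1
  have := Finset.sum_range_sub (fun k => x (partialProd (fun j => A j ω) k)) k
  rw [partialProd_zero, hx1, sub_zero] at this
  exact this

/-- The law of the product is invariant under left multiplication by `GL_n(ℤ_p)`. -/
theorem identDistrib_integralGL_mul_partialProd (hmeas : ∀ k, Measurable (A k))
    (hindep : iIndepFun A P) (hinv : IsBiInvariant (P.map (A 0))) (U : GL (Fin n) ℤ_[p]) (k : ℕ) :
    IdentDistrib (fun ω => integralGL p n U * partialProd (fun j => A j ω) (k + 1))
      (fun ω => partialProd (fun j => A j ω) (k + 1)) P P := by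
  -- The empty product 1 is not invariant in law, hence the index k + 1.
  induction k with
  | zero =>
    simp_rw [partialProd_succ, partialProd_zero, one_mul]
    refine ⟨((measurable_const_mul _).comp (hmeas 0)).aemeasurable, (hmeas 0).aemeasurable, ?_⟩
    conv_rhs => rw [← hinv.map_mul_left U]
    rw [Measure.map_map (measurable_const_mul _) (hmeas 0)]
    rfl
  | succ k ih =>
    have hi := indepFun_partialProd hmeas hindep (k + 1)
    have h := (ih.prodMk (IdentDistrib.refl (hmeas (k + 1)).aemeasurable)
      (hi.comp (measurable_const_mul (integralGL p n U)) measurable_id) hi).comp measurable_mul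
    convert h using 1
    · ext1 ω
      simp only [Function.comp_apply]
      rw [partialProd_succ _ (k + 1), mul_assoc]
    · ext1 ω
      exact partialProd_succ (fun j => A j ω) (k + 1)

end Walk

/-! ### A polynomial curve in GL_n(ℤ_p) detecting the largest minor -/

section Curve

variable {p : ℕ} [Fact p.Prime] {n : ℕ}

/-- The coefficients of a polynomial are controlled by its values at integral points. -/
theorem norm_vandermonde_mul_le {D : ℕ} (y : Fin D → ℕ) (C : Fin D → ℚ_[p]) {B : ℝ} (hB : 0 ≤ B)
    (h : ∀ j, ‖∑ d : Fin D, (y j : ℚ_[p]) ^ (d : ℕ) * C d‖ ≤ B) (d : Fin D) :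
    ‖(Matrix.vandermonde fun j => (y j : ℚ_[p])).det‖ * ‖C d‖ ≤ B := by
  set M := Matrix.vandermonde fun j => (y j : ℚ_[p])
  have hM : ∀ i j, ‖M i j‖ ≤ 1 := fun i j => by
    change ‖Matrix.vandermonde (fun j => (y j : ℚ_[p])) i j‖ ≤ 1
    rw [Matrix.vandermonde_apply, norm_pow]
    exact pow_le_one₀ (norm_nonneg _) (Padic.norm_int_le_one (y i : ℤ))
  -- Cramer's rule; the adjugate of the integral Vandermonde matrix is integral.
  have h1 : M.det • C = M.adjugate *ᵥ (M *ᵥ C) := by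
    rw [Matrix.mulVec_mulVec, Matrix.adjugate_mul, Matrix.smul_mulVec, Matrix.one_mulVec]
  have h2 := congrFun h1 d
  rw [← norm_mul, ← smul_eq_mul, ← Pi.smul_apply, h2]
  change ‖∑ j, M.adjugate d j * (M *ᵥ C) j‖ ≤ B
  refine IsUltrametricDist.norm_sum_le_of_forall_le_of_nonneg hB fun j _ => ?_
  rw [norm_mul]
  refine (mul_le_of_le_one_left (norm_nonneg _) ?_).trans (h j)
  rw [Matrix.adjugate_apply]
  refine norm_det_le_one _ fun a b => ?_
  rw [Matrix.updateRow_apply]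
  split_ifs
  · rw [Pi.single_apply]
    split_ifs <;> simp
  · exact hM a b

/-- Distinct integers may be p-adically close, but there are finitely many tuples, so one positive
bound serves them all. -/
theorem exists_pos_le_norm_vandermonde (p : ℕ) [Fact p.Prime] (D N : ℕ) :
    ∃ ε : ℝ, 0 < ε ∧ ∀ y : Fin D → Fin N, Function.Injective y →
      ε ≤ ‖(Matrix.vandermonde fun j => ((y j : ℕ) : ℚ_[p])).det‖ := by
  rcases isEmpty_or_nonempty {y : Fin D → Fin N // Function.Injective y} with he | he
  · exact ⟨1, one_pos, fun y hy => (he.false ⟨y, hy⟩).elim⟩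
  · obtain ⟨⟨y₀, hy₀⟩, hmin⟩ := Finite.exists_min
      fun y : {y : Fin D → Fin N // Function.Injective y} =>
        ‖(Matrix.vandermonde fun j => ((y.1 j : ℕ) : ℚ_[p])).det‖
    refine ⟨_, ?_, fun y hy => hmin ⟨y, hy⟩⟩
    rw [norm_pos_iff, Matrix.det_vandermonde_ne_zero_iff]
    exact fun a b hab => hy₀ (Fin.ext (Nat.cast_injective (R := ℚ_[p]) hab))

theorem isUnit_det_one_add_prime_smul (X : Matrix (Fin n) (Fin n) ℤ_[p]) :
    IsUnit (1 + (p : ℤ_[p]) • X).det := by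
  rw [← IsLocalRing.notMem_maximalIdeal, ← PadicInt.ker_toZMod, RingHom.mem_ker, RingHom.map_det]
  have : PadicInt.toZMod.mapMatrix (1 + (p : ℤ_[p]) • X) = (1 : Matrix (Fin n) (Fin n) (ZMod p)) := by
    ext a b
    simp [Matrix.one_apply, apply_ite (PadicInt.toZMod (p := p))]
  rw [this, Matrix.det_one]
  exact one_ne_zero

/-- A matrix in `GL_n(ℤ_p)` depending polynomially on `x`, such that all the maximal minors
of its last `n - i` rows have independent leading terms. -/
noncomputable def curveGL (p : ℕ) [Fact p.Prime] (n i x : ℕ) : GL (Fin n) ℤ_[p] :=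
  -- In a minor of the last rows, each corner row a contributes either its own row (digit 0) or p
  -- times row f (digit f + 1). The exponent of x is the number with these base n + 1 digits, so
  -- distinct choices give distinct monomials. Rows above the corner, where b - i truncates to 0,
  -- play no role.
  Matrix.GeneralLinearGroup.mk'' (1 + (p : ℤ_[p]) • Matrix.of fun b f : Fin n =>
    (x : ℤ_[p]) ^ ((f.val + 1) * (n + 1) ^ (b.val - i))) (isUnit_det_one_add_prime_smul _)

theorem curveGL_mul_apply (i x : ℕ) (M : Matrix (Fin n) (Fin n) ℚ_[p]) (b c : Fin n) :
    ((integralGL p n (curveGL p n i x) : Matrix (Fin n) (Fin n) ℚ_[p]) * M) b c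
      = M b c + ∑ f : Fin n,
        (x : ℚ_[p]) ^ ((f.val + 1) * (n + 1) ^ (b.val - i)) * (p * M f c) := by
  have h : (integralGL p n (curveGL p n i x) : Matrix (Fin n) (Fin n) ℚ_[p])
      = 1 + Matrix.of fun b f : Fin n =>
        (p : ℚ_[p]) * (x : ℚ_[p]) ^ ((f.val + 1) * (n + 1) ^ (b.val - i)) := by
    ext a b
    change (((1 : Matrix (Fin n) (Fin n) ℤ_[p]) a b +
      (p : ℤ_[p]) * (x : ℤ_[p]) ^ ((b.val + 1) * (n + 1) ^ (a.val - i)) : ℤ_[p]) : ℚ_[p]) = _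
    rw [Matrix.add_apply, Matrix.one_apply, Matrix.one_apply, Matrix.of_apply]
    split_ifs <;> simp
  rw [h, add_mul, Matrix.one_mul, Matrix.add_apply, Matrix.mul_apply]
  congr 1
  refine Finset.sum_congr rfl fun f _ => ?_
  rw [Matrix.of_apply]
  ring

/-- The minors along `curveGL` as polynomials in the parameter. -/
theorem det_curveGL_mul_submatrix (i x : ℕ) (M : Matrix (Fin n) (Fin n) ℚ_[p])
    (J : Fin (n - i) → Fin n) :
    (((integralGL p n (curveGL p n i x) : Matrix (Fin n) (Fin n) ℚ_[p]) * M).submatrix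
      (lastRow n i) J).det
      = ∑ d : Fin ((n + 1) ^ (n - i)), (x : ℚ_[p]) ^ (d : ℕ) *
        (Matrix.of fun a => (Fin.cons (fun c => M (lastRow n i a) (J c))
          (fun f c => p * M f (J c)) : Fin (n + 1) → Fin (n - i) → ℚ_[p])
            (finFunctionFinEquiv.symm d a)).det := by
  rw [← finFunctionFinEquiv.sum_comp]
  have h : ((integralGL p n (curveGL p n i x) : Matrix (Fin n) (Fin n) ℚ_[p]) * M).submatrix
      (lastRow n i) J = Matrix.of fun a => ∑ h : Fin (n + 1),
        (x : ℚ_[p]) ^ (h.val * (n + 1) ^ a.val) •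
          (Fin.cons (fun c => M (lastRow n i a) (J c))
            (fun f c => p * M f (J c)) : Fin (n + 1) → Fin (n - i) → ℚ_[p]) h := by
    ext a c
    rw [Matrix.submatrix_apply, curveGL_mul_apply, Matrix.of_apply, Fin.sum_univ_succ]
    simp [lastRow]
  rw [h, det_sum_smul_rows]
  refine Finset.sum_congr rfl fun h _ => ?_
  rw [Equiv.symm_apply_apply, finFunctionFinEquiv_apply, Finset.prod_pow_eq_pow_sum]

/-- Among the matrices `curveGL p n i x * g`, `x < N`, only boundedly many can have a corner
weight much larger than the sum of the last singular numbers. -/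
theorem exists_card_curveGL_lt (p : ℕ) [Fact p.Prime] (n i N : ℕ) :
    ∃ t : ℤ, ∀ g : GL (Fin n) ℚ_[p],
      ((Finset.range N).filter fun x =>
        tailSN g i + t < cornerWeight (integralGL p n (curveGL p n i x) * g) i).card
        < (n + 1) ^ (n - i) := by
  have hp := natCast_prime_pos (p := p)
  obtain ⟨ε, hε, hεle⟩ := exists_pos_le_norm_vandermonde p ((n + 1) ^ (n - i)) N
  -- The factor ε is lost in the Vandermonde inversion, and p ^ (n - i) is the scalar in front of
  -- the coefficient that is a largest minor.
  obtain ⟨t, ht⟩ : ∃ t : ℕ, ((p : ℝ)⁻¹) ^ t < ε * ((p : ℝ)⁻¹) ^ (n - i) :=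
    exists_pow_lt_of_lt_one (by positivity) (inv_lt_one_of_one_lt₀ one_lt_natCast_prime)
  refine ⟨t, fun g => ?_⟩
  by_contra! hcard
  obtain ⟨S, hS, hScard⟩ := Finset.exists_subset_card_eq hcard
  let e := (Fintype.equivFinOfCardEq (α := S) (by simpa using hScard)).symm
  have hN : ∀ j, (e j : ℕ) < N := fun j =>
    Finset.mem_range.1 (Finset.mem_filter.1 (hS (e j).2)).1
  obtain ⟨I, J, hIJ⟩ := (isSingularNumbers_SN_GL g).exists_norm_det_submatrix_eq i
  set M := (g : Matrix (Fin n) (Fin n) ℚ_[p])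
  have hval : ∀ j, ‖∑ d : Fin ((n + 1) ^ (n - i)), ((e j : ℕ) : ℚ_[p]) ^ (d : ℕ) *
        (Matrix.of fun a => (Fin.cons (fun c => M (lastRow n i a) (J c))
          (fun f c => p * M f (J c)) : Fin (n + 1) → Fin (n - i) → ℚ_[p])
            (finFunctionFinEquiv.symm d a)).det‖ ≤ (p : ℝ) ^ (-(tailSN g i + t)) := by
    intro j
    rw [← det_curveGL_mul_submatrix]
    have h1 := norm_det_le_minorNorm (corner (integralGL p n (curveGL p n i (e j)) * g) i) J
    rw [minorNorm_corner] at h1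
    refine h1.trans (zpow_le_zpow_right₀ one_lt_natCast_prime.le (neg_le_neg ?_))
    exact (Finset.mem_filter.1 (hS (e j).2)).2.le
  -- With as many bad parameters as coefficients, every coefficient would be small. The digits (I a)
  -- + 1 select the one equal to p ^ (n - i) times the largest minor, a contradiction.
  have h2 := norm_vandermonde_mul_le (fun j => (e j : ℕ)) _ (by positivity) hval
    (finFunctionFinEquiv fun a => (I a).succ)
  have h3 := hεle (fun j => ⟨e j, hN j⟩) fun a b hab => e.injective (Subtype.ext (by simpa using hab))
  simp only [Equiv.symm_apply_apply, Fin.cons_succ] at h2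
  have h4 : (Matrix.of fun a c => (p : ℚ_[p]) * M (I a) (J c)).det
      = (p : ℚ_[p]) ^ (n - i) * (M.submatrix I J).det := by
    have := Matrix.det_smul (M.submatrix I J) (p : ℚ_[p])
    rw [Fintype.card_fin] at this
    rw [← this]
    rfl
  rw [h4, norm_mul, hIJ, norm_pow, Padic.norm_p, neg_add, zpow_add₀ hp.ne', ← mul_assoc,
    mul_comm ((p : ℝ) ^ (-tailSN g i))] at h2
  have h5 := le_of_mul_le_mul_right h2 (zpow_pos hp (-tailSN g i))
  rw [zpow_neg, zpow_natCast, ← inv_pow] at h5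
  have h6 : ε * ((p : ℝ)⁻¹) ^ (n - i)
      ≤ ‖(Matrix.vandermonde fun j => ((e j : ℕ) : ℚ_[p])).det‖ * ((p : ℝ)⁻¹) ^ (n - i) :=
    mul_le_mul_of_nonneg_right h3 (by positivity)
  linarith

end Curve

/-! ### Tightness of the gap between corner weights and tail sums -/

section Tightness

variable {p : ℕ} [Fact p.Prime] {n : ℕ} {Ω : Type*} [MeasurableSpace Ω] {P : Measure Ω}
  [IsProbabilityMeasure P] {A : ℕ → Ω → GL (Fin n) ℚ_[p]}

theorem measurable_tailSN (i : ℕ) :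
    Measurable fun g : GL (Fin n) ℚ_[p] => (tailSN g i : ℝ) := by
  simp_rw [tailSN_eq_inf']
  exact (Continuous.finset_inf'_apply _ fun σ _ =>
    (continuous_cornerWeight i).comp (continuous_const_mul _)).measurable

/-- The corner weights of the products differ from the sums of the last singular numbers by
a tight sequence. -/
theorem exists_measure_cornerWeight_sub_tailSN_le (hmeas : ∀ k, Measurable (A k))
    (hindep : iIndepFun A P) (hinv : IsBiInvariant (P.map (A 0))) (i : ℕ) {η : ℝ} (hη : 0 < η) :
    ∃ t : ℝ, ∀ k, P.real {ω | t < (cornerWeight (partialProd (fun j => A j ω) (k + 1)) i : ℝ)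
      - tailSN (partialProd (fun j => A j ω) (k + 1)) i} ≤ η := by
  -- The N events `C x` below are equally likely by invariance, and fewer than (n + 1) ^ (n - i) of
  -- them occur at once, so each has probability at most (n + 1) ^ (n - i) / N < η.
  obtain ⟨N, hN⟩ := exists_nat_gt (((n + 1) ^ (n - i) : ℕ) / η)
  have hN0 : (0 : ℝ) < N := lt_of_le_of_lt (by positivity) hN
  obtain ⟨t, ht⟩ := exists_card_curveGL_lt p n i N
  refine ⟨t, fun k => ?_⟩
  set Q : Ω → GL (Fin n) ℚ_[p] := fun ω => partialProd (fun j => A j ω) (k + 1)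
  have hQ : Measurable Q := measurable_partialProd hmeas _
  let B : Set (GL (Fin n) ℚ_[p]) := {g | (t : ℝ) < (cornerWeight g i : ℝ) - tailSN g i}
  have hB : MeasurableSet B :=
    measurableSet_lt measurable_const ((measurable_cornerWeight i).sub (measurable_tailSN i))
  let C : ℕ → Set Ω := fun x => (fun ω => integralGL p n (curveGL p n i x) * Q ω) ⁻¹' B
  have hC : ∀ x, MeasurableSet (C x) := fun x => ((measurable_const_mul _).comp hQ) hB
  have hPC : ∀ x, P.real (C x) = P.real (Q ⁻¹' B) := fun x => by
    have h := (identDistrib_integralGL_mul_partialProd hmeas hindep hinv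
      (curveGL p n i x) k).measure_mem_eq hB
    exact congrArg ENNReal.toReal h
  have hsum : ∑ x ∈ Finset.range N, P.real (C x) ≤ ((n + 1) ^ (n - i) : ℕ) := by
    have h1 : ∑ x ∈ Finset.range N, P.real (C x)
        = ∫ ω, ∑ x ∈ Finset.range N, (C x).indicator (fun _ => (1 : ℝ)) ω ∂P := by
      rw [integral_finsetSum _ fun x _ => (integrable_const 1).indicator (hC x)]
      refine Finset.sum_congr rfl fun x _ => ?_
      rw [integral_indicator_const _ (hC x), smul_eq_mul, mul_one]
    have h2 : ∫ _, (((n + 1) ^ (n - i) : ℕ) : ℝ) ∂P = ((n + 1) ^ (n - i) : ℕ) := by simp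
    rw [h1, ← h2]
    refine integral_mono (integrable_finsetSum _ fun x _ => (integrable_const 1).indicator (hC x))
      (integrable_const _) fun ω => ?_
    have h3 := (ht (Q ω)).le
    rw [Finset.card_filter] at h3
    refine le_trans (le_of_eq ?_) (Nat.cast_le.2 h3)
    rw [Nat.cast_sum]
    refine Finset.sum_congr rfl fun x _ => ?_
    have h4 : ω ∈ C x ↔ tailSN (Q ω) i + t
        < cornerWeight (integralGL p n (curveGL p n i x) * Q ω) i := by
      change (t : ℝ) < _ - _ ↔ _
      rw [tailSN_integralGL_mul, lt_sub_iff_add_lt, add_comm (t : ℝ)]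
      exact_mod_cast Iff.rfl
    by_cases h5 : tailSN (Q ω) i + t < cornerWeight (integralGL p n (curveGL p n i x) * Q ω) i
    · rw [Set.indicator_of_mem (h4.2 h5), if_pos h5, Nat.cast_one]
    · rw [Set.indicator_of_notMem (mt h4.1 h5), if_neg h5, Nat.cast_zero]
  simp_rw [hPC, Finset.sum_const, Finset.card_range, nsmul_eq_mul] at hsum
  rw [div_lt_iff₀ hη] at hN
  exact le_of_mul_le_mul_left (hsum.trans hN.le) hN0

end Tightness

/-! ### Multivariate central limit theorem via characteristic functions -/

section CentralLimit

variable {Ω : Type*} [MeasurableSpace Ω] {P : Measure Ω}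

theorem TendstoInDistribution.congr_identDistrib [IsProbabilityMeasure P] {E Ω' : Type*} [MeasurableSpace E]
    [TopologicalSpace E] [OpensMeasurableSpace E] [MeasurableSpace Ω'] {P' : Measure Ω'}
    [IsProbabilityMeasure P'] {X Y : ℕ → Ω → E} {Z : Ω' → E} {l : Filter ℕ}
    (h : TendstoInDistribution X l Z (fun _ => P) P') (hXY : ∀ k, IdentDistrib (X k) (Y k) P P) :
    TendstoInDistribution Y l Z (fun _ => P) P' where
  forall_aemeasurable k := (hXY k).aemeasurable_snd
  aemeasurable_limit := h.aemeasurable_limit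
  tendsto := h.tendsto.congr fun k => Subtype.ext (hXY k).map_eq

variable {ι : Type*} [Fintype ι]

/-- Cramér–Wold reduction: the frequency t is absorbed into a real projection, so the
one-dimensional theorem is only needed at frequency 1. -/
theorem charFun_map_eq_charFun_inner {Z : Ω → EuclideanSpace ℝ ι} (hZ : AEMeasurable Z P)
    (t : EuclideanSpace ℝ ι) :
    charFun (P.map Z) t = charFun (P.map fun ω => inner ℝ (Z ω) t) 1 := by
  have h1 : AEMeasurable (fun ω => inner ℝ (Z ω) t) P := hZ.inner_const
  rw [charFun_apply, charFun_apply, integral_map hZ (by fun_prop), integral_map h1 (by fun_prop)]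
  simp

/-- The normalised partial sums of a sequence of random vectors. -/
noncomputable def normalizedSum (X : ℕ → Ω → EuclideanSpace ℝ ι) (P : Measure Ω) (k : ℕ) (ω : Ω) :
    EuclideanSpace ℝ ι :=
  (√(k : ℝ))⁻¹ • (∑ j ∈ Finset.range k, X j ω
    - (k : ℝ) • WithLp.toLp 2 fun i => ∫ ω, X 0 ω i ∂P)

theorem aemeasurable_normalizedSum {X : ℕ → Ω → EuclideanSpace ℝ ι}
    (hX : ∀ k, AEMeasurable (X k) P) (k : ℕ) : AEMeasurable (normalizedSum X P k) P := by
  have h : AEMeasurable (fun ω => ∑ j ∈ Finset.range k, X j ω) P :=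
    Finset.aemeasurable_fun_sum _ fun j _ => hX j
  exact (h.sub_const _).const_smul (√(k : ℝ))⁻¹

variable [IsProbabilityMeasure P]

/-- The covariance matrix of a random vector. -/
noncomputable def covMatrix (X : ι → Ω → ℝ) (P : Measure Ω) : Matrix ι ι ℝ :=
  Matrix.of fun i j => cov[X i, X j; P]

theorem dotProduct_covMatrix {X : ι → Ω → ℝ} (hX : ∀ i, MemLp (X i) 2 P) (t : ι → ℝ) :
    t ⬝ᵥ covMatrix X P *ᵥ t = Var[fun ω => ∑ i, t i * X i ω; P] := by
  have hX' : ∀ i, MemLp (fun ω => t i * X i ω) 2 P := fun i => (hX i).const_mul (t i)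
  rw [← covariance_self (memLp_finsetSum _ fun i _ => hX' i).aestronglyMeasurable.aemeasurable,
    covariance_fun_sum_fun_sum hX' hX']
  simp_rw [covariance_const_mul_left, covariance_const_mul_right, dotProduct, Matrix.mulVec,
    dotProduct, Finset.mul_sum, covMatrix, Matrix.of_apply]
  exact Finset.sum_congr rfl fun i _ => Finset.sum_congr rfl fun j _ => by ring

theorem posSemidef_covMatrix {X : ι → Ω → ℝ} (hX : ∀ i, MemLp (X i) 2 P) :
    (covMatrix X P).PosSemidef := by
  refine Matrix.PosSemidef.of_dotProduct_mulVec_nonneg ?_ fun t => ?_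
  · ext i j
    exact covariance_comm _ _
  · rw [star_trivial, dotProduct_covMatrix hX]
    exact variance_nonneg _ _

theorem inner_normalizedSum {X : ℕ → Ω → EuclideanSpace ℝ ι}
    (hX : ∀ i, MemLp (fun ω => X 0 ω i) 2 P) (t : EuclideanSpace ℝ ι) (k : ℕ) (ω : Ω) :
    inner ℝ (normalizedSum X P k ω) t = (√(k : ℝ))⁻¹ *
      (∑ j ∈ Finset.range k, inner ℝ (X j ω) t - k * ∫ ω, inner ℝ (X 0 ω) t ∂P) := by
  have hYmean : ∫ ω, inner ℝ (X 0 ω) t ∂P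
      = inner ℝ (WithLp.toLp 2 fun i => ∫ ω, X 0 ω i ∂P) t := by
    simp only [PiLp.inner_apply]
    rw [integral_finsetSum _ fun i _ => ((hX i).integrable one_le_two).inner_const _]
    exact Finset.sum_congr rfl fun i _ => by
      simp only [RCLike.inner_apply, conj_trivial]
      rw [integral_const_mul]
  rw [normalizedSum, hYmean, real_inner_smul_left, inner_sub_left, sum_inner,
    real_inner_smul_left]

theorem tendsto_charFun_inv_sqrt_mul_sum_sub {Y : ℕ → Ω → ℝ} (hY : MemLp (Y 0) 2 P)
    (hindep : iIndepFun Y P) (hident : ∀ k, IdentDistrib (Y k) (Y 0) P P) :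
    Tendsto (fun k : ℕ => charFun (P.map fun ω => (√(k : ℝ))⁻¹ *
      (∑ j ∈ Finset.range k, Y j ω - k * P[Y 0])) 1) atTop
      (𝓝 (Complex.exp (-(Var[Y 0; P] : ℂ) / 2))) := by
  have hclt := tendstoInDistribution_inv_sqrt_mul_sum_sub
    (P' := gaussianReal 0 Var[Y 0; P].toNNReal) (Y := id) HasLaw.id hY hindep hident
  have hlim := (ProbabilityMeasure.tendsto_iff_tendsto_charFun.1 hclt.tendsto) 1
  simp only [ProbabilityMeasure.coe_mk, Measure.map_id] at hlim
  rw [charFun_gaussianReal, Real.coe_toNNReal _ (variance_nonneg _ _)] at hlim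
  convert hlim using 3
  simp [neg_div]

variable [DecidableEq ι]

theorem tendsto_charFun_normalizedSum {X : ℕ → Ω → EuclideanSpace ℝ ι}
    (hX : ∀ i, MemLp (fun ω => X 0 ω i) 2 P) (hindep : iIndepFun X P)
    (hident : ∀ k, IdentDistrib (X k) (X 0) P P) (t : EuclideanSpace ℝ ι) :
    Tendsto (fun k => charFun (P.map (normalizedSum X P k)) t) atTop
      (𝓝 (charFun (multivariateGaussian 0 (covMatrix (fun i ω => X 0 ω i) P)) t)) := by
  have hinner : ∀ ω, inner ℝ (X 0 ω) t = ∑ i, t i * X 0 ω i := fun ω => by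
    simp [PiLp.inner_apply]
  have hmeas : Measurable fun x : EuclideanSpace ℝ ι => inner ℝ x t := by fun_prop
  have hY2 : MemLp (fun ω => inner ℝ (X 0 ω) t) 2 P := by
    simp_rw [hinner]
    exact memLp_finsetSum _ fun i _ => (hX i).const_mul (t i)
  have hvar : t.ofLp ⬝ᵥ covMatrix (fun i ω => X 0 ω i) P *ᵥ t.ofLp
      = Var[fun ω => inner ℝ (X 0 ω) t; P] := by
    rw [dotProduct_covMatrix hX]
    simp_rw [hinner]
  have hlim := tendsto_charFun_inv_sqrt_mul_sum_sub hY2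
    (hindep.comp (fun _ x => inner ℝ x t) fun _ => hmeas) fun k => (hident k).comp hmeas
  rw [charFun_multivariateGaussian (posSemidef_covMatrix hX), hvar, inner_zero_right,
    Complex.ofReal_zero, zero_mul, zero_sub, ← neg_div]
  refine hlim.congr fun k => ?_
  rw [charFun_map_eq_charFun_inner (aemeasurable_normalizedSum
    (fun k => (hident k).aemeasurable_fst) k)]
  simp_rw [inner_normalizedSum hX]
  rfl

/-- The multivariate central limit theorem. -/
theorem tendstoInDistribution_normalizedSum {X : ℕ → Ω → EuclideanSpace ℝ ι}
    (hX : ∀ i, MemLp (fun ω => X 0 ω i) 2 P) (hindep : iIndepFun X P)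
    (hident : ∀ k, IdentDistrib (X k) (X 0) P P) :
    TendstoInDistribution (normalizedSum X P) atTop
      (id : EuclideanSpace ℝ ι → EuclideanSpace ℝ ι) (fun _ => P)
      (multivariateGaussian 0 (covMatrix (fun i ω => X 0 ω i) P)) where
  forall_aemeasurable := aemeasurable_normalizedSum fun k => (hident k).aemeasurable_fst
  tendsto := by
    refine ProbabilityMeasure.tendsto_iff_tendsto_charFun.2 fun t => ?_
    have h := tendsto_charFun_normalizedSum hX hindep hident t
    rw [← Measure.map_id (μ := multivariateGaussian 0 (covMatrix (fun i ω => X 0 ω i) P))] at h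
    exact h

end CentralLimit

/-! ### Splitness and the strong law for singular numbers -/

section Limits

variable {p : ℕ} [Fact p.Prime] {n : ℕ}

theorem cornerWeight_of_le (g : GL (Fin n) ℚ_[p]) {i : ℕ} (hi : n ≤ i) : cornerWeight g i = 0 := by
  have : IsEmpty (Fin (n - i)) := by rw [Nat.sub_eq_zero_of_le hi]; infer_instance
  simp [cornerWeight]

theorem tailSN_of_le (g : GL (Fin n) ℚ_[p]) {i : ℕ} (hi : n ≤ i) : tailSN g i = 0 := by
  have : IsEmpty (Fin (n - i)) := by rw [Nat.sub_eq_zero_of_le hi]; infer_instance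
  simp [tailSN, tailSum]

/-- Applying the cocycle identity to Ug gives some V; conjugating back, U⁻¹V serves for g. The
permuted corners in `tailSN_eq_inf'` are thus cocycles. -/
theorem isFlagCocycle_cornerWeight (U : GL (Fin n) ℤ_[p]) (i : ℕ) :
    IsFlagCocycle fun g : GL (Fin n) ℚ_[p] => (cornerWeight (integralGL p n U * g) i : ℝ) := by
  intro g
  obtain ⟨V, hV⟩ := exists_cornerWeight_mul (integralGL p n U * g)
  refine ⟨U⁻¹ * V, fun h => ?_⟩
  change (cornerWeight (integralGL p n U * (g * h)) i : ℝ) = cornerWeight (integralGL p n U * g) i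
    + cornerWeight (integralGL p n U * (integralGL p n (U⁻¹ * V) * h)) i
  rw [← mul_assoc (integralGL p n U) g h, hV, ← mul_assoc (integralGL p n U), ← map_mul,
    mul_inv_cancel_left, Int.cast_add]

theorem tendsto_tailSN_div {g : ℕ → GL (Fin n) ℚ_[p]} {i : ℕ} {m : ℝ}
    (h : ∀ σ : Equiv.Perm (Fin n), Tendsto (fun k : ℕ =>
      (cornerWeight (integralGL p n (permGL p σ) * g k) i : ℝ) / k) atTop (𝓝 m)) :
    Tendsto (fun k : ℕ => (tailSN (g k) i : ℝ) / k) atTop (𝓝 m) := by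
  have h1 := Tendsto.finset_inf'_nhds_apply (s := (Finset.univ : Finset (Equiv.Perm (Fin n))))
    ⟨1, Finset.mem_univ _⟩ fun σ _ => h σ
  have h2 : Finset.univ.inf' ⟨1, Finset.mem_univ _⟩ (fun _ : Equiv.Perm (Fin n) => m) = m :=
    Finset.inf'_const _ _
  rw [h2] at h1
  refine h1.congr fun k => ?_
  rw [tailSN_eq_inf']
  have hmono : Monotone fun x : ℝ => x / k := fun x y hxy =>
    div_le_div_of_nonneg_right hxy (Nat.cast_nonneg k)
  exact (Finset.apply_inf'_eq_inf'_comp _ (fun x : ℝ => x / k) fun x y => hmono.map_inf x y).symm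

/-- The term y_k is a difference of consecutive partial sums. The strong law thus makes each single
summand o(k) almost surely. -/
theorem tendsto_div_of_tendsto_sum_div {y : ℕ → ℝ} {m : ℝ}
    (h : Tendsto (fun k : ℕ => (∑ j ∈ Finset.range k, y j) / k) atTop (𝓝 m)) :
    Tendsto (fun k : ℕ => y k / k) atTop (𝓝 0) := by
  have h1 := (tendsto_add_atTop_iff_nat 1).2 h
  have h2 : Tendsto (fun k : ℕ => ((k + 1 : ℕ) : ℝ) / k) atTop (𝓝 1) := by
    have := (tendsto_const_nhds (x := (1 : ℝ))).add (tendsto_inv_atTop_nhds_zero_nat (𝕜 := ℝ))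
    rw [add_zero] at this
    refine this.congr' ?_
    filter_upwards [eventually_ne_atTop 0] with k hk
    have : (k : ℝ) ≠ 0 := by exact_mod_cast hk
    push_cast
    field_simp
  have h3 := (h1.mul h2).sub h
  rw [mul_one, sub_self] at h3
  refine h3.congr' ?_
  filter_upwards [eventually_ne_atTop 0] with k hk
  have : (k : ℝ) ≠ 0 := by exact_mod_cast hk
  have h4 : ((k + 1 : ℕ) : ℝ) ≠ 0 := by positivity
  rw [Finset.sum_range_succ]
  field_simp
  ring

theorem tendsto_atTop_of_tendsto_div {z : ℕ → ℤ} {c : ℝ} (hc : 0 < c)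
    (h : Tendsto (fun k : ℕ => (z k : ℝ) / k) atTop (𝓝 c)) : Tendsto z atTop atTop := by
  rw [← tendsto_intCast_atTop_iff (R := ℝ)]
  refine (h.pos_mul_atTop hc tendsto_natCast_atTop_atTop).congr' ?_
  filter_upwards [eventually_ne_atTop 0] with k hk
  exact div_mul_cancel₀ _ (by exact_mod_cast hk)

variable {Ω : Type*} [MeasurableSpace Ω] {P : Measure Ω} {A : ℕ → Ω → GL (Fin n) ℚ_[p]}

theorem measurable_cornerWeight_mul (U : GL (Fin n) ℤ_[p]) (i : ℕ) :
    Measurable fun g : GL (Fin n) ℚ_[p] => (cornerWeight (integralGL p n U * g) i : ℝ) :=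
  (measurable_cornerWeight i).comp (measurable_const_mul _)

theorem identDistrib_cornerWeight (hmeas : ∀ k, Measurable (A k))
    (hinv : IsBiInvariant (P.map (A 0))) (U : GL (Fin n) ℤ_[p]) (i : ℕ) :
    IdentDistrib (fun ω => (cornerWeight (integralGL p n U * A 0 ω) i : ℝ))
      (fun ω => (cornerWeight (A 0 ω) i : ℝ)) P P := by
  have h := hinv.identDistrib_cornerWeight U i
  refine ⟨((measurable_cornerWeight_mul U i).comp (hmeas 0)).aemeasurable,
    ((measurable_cornerWeight i).comp (hmeas 0)).aemeasurable, ?_⟩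
  have h1 := h.map_eq
  rw [Measure.map_map (measurable_cornerWeight_mul U i) (hmeas 0),
    Measure.map_map (measurable_cornerWeight i) (hmeas 0)] at h1
  exact h1

theorem strong_law_cornerWeight (hmeas : ∀ k, Measurable (A k)) (hindep : iIndepFun A P)
    (hident : ∀ k, IdentDistrib (A k) (A 0) P P) (hinv : IsBiInvariant (P.map (A 0)))
    (hint : ∀ i, Integrable (fun ω => (cornerWeight (A 0 ω) i : ℝ)) P) :
    ∀ᵐ ω ∂P, ∀ i (σ : Equiv.Perm (Fin n)), Tendsto (fun k : ℕ => (∑ j ∈ Finset.range k,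
      (cornerWeight (integralGL p n (permGL p σ) * A j ω) i : ℝ)) / k) atTop
      (𝓝 (∫ ω, (cornerWeight (A 0 ω) i : ℝ) ∂P)) := by
  refine ae_all_iff.2 fun i => ae_all_iff.2 fun σ => ?_
  have hid := identDistrib_cornerWeight hmeas hinv (permGL p σ) i
  have hx := measurable_cornerWeight_mul (p := p) (permGL p σ) i
  rw [← hid.integral_eq]
  exact strong_law_ae_real
    (fun j ω => (cornerWeight (integralGL p n (permGL p σ) * A j ω) i : ℝ))
    (hid.integrable_iff.2 (hint i))
    (fun j k hjk => (hindep.indepFun hjk).comp hx hx) fun k => (hident k).comp hx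

theorem permGL_one : permGL p (1 : Equiv.Perm (Fin n)) = 1 := Units.ext rfl

/-- The sequence of accumulated corner weights is almost surely split. -/
theorem ae_isSplit (hmeas : ∀ k, Measurable (A k)) (hindep : iIndepFun A P)
    (hident : ∀ k, IdentDistrib (A k) (A 0) P P) (hinv : IsBiInvariant (P.map (A 0)))
    (hint : ∀ i, Integrable (fun ω => (cornerWeight (A 0 ω) i : ℝ)) P)
    (hlt : ∀ i, i + 1 < n →
      (∫ ω, (cornerWeight (A 0 ω) (i + 1) : ℝ) ∂P) - (∫ ω, (cornerWeight (A 0 ω) (i + 2) : ℝ) ∂P)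
        < (∫ ω, (cornerWeight (A 0 ω) i : ℝ) ∂P)
          - (∫ ω, (cornerWeight (A 0 ω) (i + 1) : ℝ) ∂P)) :
    ∀ᵐ ω ∂P, IsSplit (fun j => A j ω) (cornerSequence fun j => A j ω) := by
  filter_upwards [strong_law_cornerWeight hmeas hindep hident hinv hint] with ω hω i hi
  have hc : ∀ i, Tendsto (fun k : ℕ => (∑ j ∈ Finset.range k, (cornerWeight (A j ω) i : ℝ)) / k)
      atTop (𝓝 (∫ ω, (cornerWeight (A 0 ω) i : ℝ) ∂P)) := fun i => by
    simpa [permGL_one] using hω i 1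
  have hv : ∀ i : Fin n, Tendsto (fun k : ℕ => (cornerSequence (fun j => A j ω) k i : ℝ) / k)
      atTop (𝓝 ((∫ ω, (cornerWeight (A 0 ω) i : ℝ) ∂P)
        - ∫ ω, (cornerWeight (A 0 ω) (i + 1) : ℝ) ∂P)) := fun i => by
    refine ((hc i).sub (hc (i + 1))).congr fun k => ?_
    rw [cornerSequence]
    push_cast
    rw [Finset.sum_sub_distrib, sub_div]
  -- The smallest singular number is the tail sum at n - 1, a minimum of permuted corner weights
  -- each of which is o(k).
  have hlast : Tendsto (fun k : ℕ =>
      (SN (A k ω : Matrix (Fin n) (Fin n) ℚ_[p]) ⟨n - 1, by omega⟩ : ℝ) / k) atTop (𝓝 0) := by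
    have h := tendsto_tailSN_div (g := fun k => A k ω) fun σ =>
      tendsto_div_of_tendsto_sum_div (hω (n - 1) σ)
    refine h.congr fun k => ?_
    rw [SN_eq_tailSN_sub, tailSN_of_le _ (show n ≤ n - 1 + 1 by omega), sub_zero]
  have hinc : Tendsto (fun k : ℕ =>
      ((cornerWeight (A k ω) (i + 1) : ℝ) - cornerWeight (A k ω) (i + 2)) / k) atTop (𝓝 0) := by
    have := (tendsto_div_of_tendsto_sum_div (hc (i + 1))).sub
      (tendsto_div_of_tendsto_sum_div (hc (i + 2)))
    rw [sub_zero] at this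
    exact this.congr fun k => (sub_div _ _ _).symm
  -- Divided by k, the expression converges to the difference of two consecutive means, which is
  -- positive.
  refine tendsto_atTop_of_tendsto_div (sub_pos.2 (hlt i hi)) ?_
  have h := ((hv ⟨i, by omega⟩).sub ((hv ⟨i + 1, hi⟩).add hinc)).add hlast
  rw [add_zero, add_zero] at h
  refine h.congr fun k => ?_
  have hs : cornerSequence (fun j => A j ω) (k + 1) ⟨i + 1, hi⟩
      = cornerSequence (fun j => A j ω) k ⟨i + 1, hi⟩
        + (cornerWeight (A k ω) (i + 1) - cornerWeight (A k ω) (i + 2)) :=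
    Finset.sum_range_succ _ _
  rw [hs]
  push_cast
  ring

variable [IsProbabilityMeasure P]

/-- Strong law of large numbers for the tails of the singular numbers of the products. -/
theorem strong_law_tailSN (hmeas : ∀ k, Measurable (A k)) (hindep : iIndepFun A P)
    (hident : ∀ k, IdentDistrib (A k) (A 0) P P) (hinv : IsBiInvariant (P.map (A 0)))
    (hint : ∀ i, Integrable (fun ω => (cornerWeight (A 0 ω) i : ℝ)) P) :
    ∀ᵐ ω ∂P, ∀ i, Tendsto (fun k : ℕ => (tailSN (partialProd (fun j => A j ω) k) i : ℝ) / k)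
      atTop (𝓝 (∫ ω, (cornerWeight (A 0 ω) i : ℝ) ∂P)) := by
  have h : ∀ i (σ : Equiv.Perm (Fin n)), ∀ᵐ ω ∂P, Tendsto (fun k : ℕ =>
      (cornerWeight (integralGL p n (permGL p σ) * partialProd (fun j => A j ω) k) i : ℝ) / k)
      atTop (𝓝 (∫ ω, (cornerWeight (A 0 ω) i : ℝ) ∂P)) := by
    intro i σ
    have hid := identDistrib_cornerWeight hmeas hinv (permGL p σ) i
    rw [← hid.integral_eq]
    have h1 : (cornerWeight (integralGL p n (permGL p σ) * 1) i : ℝ) = 0 := by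
      rw [mul_one, cornerWeight_integralGL, Int.cast_zero]
    have h2 := strong_law_walk
      (x := fun g => (cornerWeight (integralGL p n (permGL p σ) * g) i : ℝ))
      (measurable_cornerWeight_mul (permGL p σ) i)
      (isFlagCocycle_cornerWeight (permGL p σ) i) h1 hmeas hindep hident hinv
      (hid.integrable_iff.2 (hint i))
    exact h2
  filter_upwards [ae_all_iff.2 fun i => ae_all_iff.2 (h i)] with ω hω i
  exact tendsto_tailSN_div (hω i)

end Limits

/-! ### The central limit theorem for singular numbers -/

section Fluctuations

variable {p : ℕ} [Fact p.Prime] {n : ℕ} {Ω : Type*} [MeasurableSpace Ω] {P : Measure Ω}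
  [IsProbabilityMeasure P] {A : ℕ → Ω → GL (Fin n) ℚ_[p]}

/-- The vector of differences of successive corner weights. -/
noncomputable def cornerVector (g : GL (Fin n) ℚ_[p]) : EuclideanSpace ℝ (Fin n) :=
  WithLp.toLp 2 fun i => (cornerWeight g i : ℝ) - cornerWeight g (i + 1)

/-- The vector of singular numbers. -/
noncomputable def vectorSN (g : GL (Fin n) ℚ_[p]) : EuclideanSpace ℝ (Fin n) :=
  WithLp.toLp 2 fun i => (SN (g : Matrix (Fin n) (Fin n) ℚ_[p]) i : ℝ)

/-- The total discrepancy between corner weights and tails of singular numbers. -/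
noncomputable def discrepancy (g : GL (Fin n) ℚ_[p]) : ℝ :=
  ∑ i ∈ Finset.range (n + 1), ((cornerWeight g i : ℝ) - tailSN g i)

theorem measurable_cornerVector :
    Measurable (cornerVector : GL (Fin n) ℚ_[p] → EuclideanSpace ℝ (Fin n)) :=
  (WithLp.measurable_toLp 2 _).comp (measurable_pi_lambda _ fun i : Fin n =>
    (measurable_cornerWeight i).sub (measurable_cornerWeight (i + 1)))

theorem measurable_vectorSN :
    Measurable (vectorSN : GL (Fin n) ℚ_[p] → EuclideanSpace ℝ (Fin n)) := by
  refine (WithLp.measurable_toLp 2 _).comp (measurable_pi_lambda _ fun i : Fin n => ?_)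
  simp_rw [SN_eq_tailSN_sub, Int.cast_sub]
  exact (measurable_tailSN i).sub (measurable_tailSN (i + 1))

theorem isFlagCocycle_cornerVector :
    IsFlagCocycle (cornerVector : GL (Fin n) ℚ_[p] → EuclideanSpace ℝ (Fin n)) := by
  intro g
  obtain ⟨V, hV⟩ := exists_cornerWeight_mul g
  refine ⟨V, fun h => ?_⟩
  ext i
  simp only [cornerVector, PiLp.add_apply, hV, Int.cast_add]
  ring

theorem cornerVector_one : cornerVector (1 : GL (Fin n) ℚ_[p]) = 0 := by
  have h : ∀ i, cornerWeight (1 : GL (Fin n) ℚ_[p]) i = 0 := fun i => by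
    simpa using cornerWeight_integralGL (p := p) (1 : GL (Fin n) ℤ_[p]) i
  ext i
  simp [cornerVector, h]

/-- With d_i = w_i - s_i ≥ 0, coordinate i of the difference is d_{i+1} - d_i, and each d_i occurs
at most twice. -/
theorem norm_vectorSN_sub_cornerVector_le (g : GL (Fin n) ℚ_[p]) :
    ‖vectorSN g - cornerVector g‖ ≤ 2 * discrepancy g := by
  set d : ℕ → ℝ := fun i => (cornerWeight g i : ℝ) - tailSN g i
  have hd : ∀ i, 0 ≤ d i := fun i => sub_nonneg.2 (by exact_mod_cast tailSN_le_cornerWeight g i)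
  set x := vectorSN g - cornerVector g
  have hx : ∀ i : Fin n, x i = d (i + 1) - d i := fun i => by
    simp only [x, d, vectorSN, cornerVector, PiLp.sub_apply, SN_eq_tailSN_sub, Int.cast_sub]
    ring
  have h1 : ‖x‖ ≤ ∑ i, |x i| := by
    conv_lhs => rw [← (EuclideanSpace.basisFun (Fin n) ℝ).sum_repr x]
    refine (norm_sum_le _ _).trans (Finset.sum_le_sum fun i _ => ?_)
    simp [norm_smul]
  refine h1.trans ?_
  have h2 : ∑ i : Fin n, |x i| ≤ ∑ i : Fin n, (d (i + 1) + d i) := by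
    refine Finset.sum_le_sum fun i _ => ?_
    rw [hx, abs_le]
    constructor <;> linarith [hd i, hd (i + 1)]
  refine h2.trans ?_
  rw [Fin.sum_univ_eq_sum_range fun i => d (i + 1) + d i, Finset.sum_add_distrib, two_mul]
  refine add_le_add ?_ ?_
  · rw [discrepancy, Finset.sum_range_succ']
    exact le_add_of_nonneg_right (hd 0)
  · rw [discrepancy, Finset.sum_range_succ]
    exact le_add_of_nonneg_right (hd n)

theorem exists_measure_discrepancy_le (hmeas : ∀ k, Measurable (A k))
    (hindep : iIndepFun A P) (hinv : IsBiInvariant (P.map (A 0))) {η : ℝ} (hη : 0 < η) :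
    ∃ t : ℝ, ∀ k, P.real {ω | t < discrepancy (partialProd (fun j => A j ω) (k + 1))} ≤ η := by
  have hη' : 0 < η / (n + 1 : ℕ) := by positivity
  choose t ht using fun i => exists_measure_cornerWeight_sub_tailSN_le hmeas hindep hinv i hη'
  refine ⟨∑ i ∈ Finset.range (n + 1), t i, fun k => ?_⟩
  refine (measureReal_mono (h₂ := measure_ne_top _ _) (s₂ := ⋃ i ∈ Finset.range (n + 1), {ω | t i <
    (cornerWeight (partialProd (fun j => A j ω) (k + 1)) i : ℝ)
      - tailSN (partialProd (fun j => A j ω) (k + 1)) i}) fun ω hω => ?_).trans ?_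
  · obtain ⟨i, hi, h⟩ := Finset.exists_lt_of_sum_lt
      (show _ < ∑ i ∈ Finset.range (n + 1), ((cornerWeight _ i : ℝ) - tailSN _ i) from hω)
    exact Set.mem_biUnion hi h
  · refine (measureReal_biUnion_finset_le _ _).trans ?_
    refine (Finset.sum_le_sum fun i _ => ht i k).trans (le_of_eq ?_)
    rw [Finset.sum_const, Finset.card_range, nsmul_eq_mul]
    exact mul_div_cancel₀ _ (by positivity)

/-- The central limit theorem for the singular numbers of the products. -/
theorem tendstoInDistribution_vectorSN (hmeas : ∀ k, Measurable (A k)) (hindep : iIndepFun A P)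
    (hident : ∀ k, IdentDistrib (A k) (A 0) P P) (hinv : IsBiInvariant (P.map (A 0)))
    (hL2 : ∀ i, MemLp (fun ω => (cornerWeight (A 0 ω) i : ℝ)) 2 P) :
    TendstoInDistribution
      (fun (k : ℕ) ω => (√(k : ℝ))⁻¹ • (vectorSN (partialProd (fun j => A j ω) k)
        - (k : ℝ) • WithLp.toLp 2 fun i => ∫ ω, cornerVector (A 0 ω) i ∂P)) atTop
      (id : EuclideanSpace ℝ (Fin n) → EuclideanSpace ℝ (Fin n)) (fun _ => P)
      (multivariateGaussian 0 (covMatrix (fun i ω => cornerVector (A 0 ω) i) P)) := by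
  set m : EuclideanSpace ℝ (Fin n) := WithLp.toLp 2 fun i => ∫ ω, cornerVector (A 0 ω) i ∂P
  have hclt := tendstoInDistribution_normalizedSum (X := fun j ω => cornerVector (A j ω))
    (fun i => (hL2 i).sub (hL2 (i + 1))) (hindep.comp (fun _ => cornerVector)
      fun _ => measurable_cornerVector) fun k => (hident k).comp measurable_cornerVector
  -- Equality in law for each fixed k suffices to pass from sums over independent matrices to corner
  -- weights of products.
  have hwalk := TendstoInDistribution.congr_identDistrib
    (Y := fun (k : ℕ) ω => (√(k : ℝ))⁻¹ • (cornerVector (partialProd (fun j => A j ω) k)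
      - (k : ℝ) • m)) hclt fun k =>
    ((identDistrib_walk_sum measurable_cornerVector isFlagCocycle_cornerVector cornerVector_one
      hmeas hindep hident hinv k).symm.comp (u := fun x => (√(k : ℝ))⁻¹ • (x - (k : ℝ) • m))
        (by fun_prop))
  have hSN : ∀ k : ℕ, Measurable fun ω => (√(k : ℝ))⁻¹ •
      (vectorSN (partialProd (fun j => A j ω) k) - (k : ℝ) • m) := fun k => by
    have := measurable_vectorSN.comp (measurable_partialProd hmeas k)
    exact (this.sub_const _).const_smul (√(k : ℝ))⁻¹
  -- Slutsky: it remains to see that the discrepancy is o(√k) in probability.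
  refine tendstoInDistribution_of_tendstoInMeasure_sub _ _ hwalk ?_ fun k => (hSN k).aemeasurable
  rw [tendstoInMeasure_iff_measureReal_norm]
  intro ε hε
  -- The tightness bound is available for nonempty products only.
  rw [← tendsto_add_atTop_iff_nat 1, Metric.tendsto_atTop]
  intro η hη
  obtain ⟨t, ht⟩ := exists_measure_discrepancy_le hmeas hindep hinv (half_pos hη)
  -- The ε / 2 matches the factor 2 in `norm_vectorSN_sub_cornerVector_le`: a deviation of at least
  -- ε forces the discrepancy above t.
  obtain ⟨K, hK⟩ := (((Real.tendsto_sqrt_atTop.comp tendsto_natCast_atTop_atTop).const_mul_atTop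
    (half_pos hε)).eventually_gt_atTop t).exists_forall_of_atTop
  refine ⟨K, fun k hk => ?_⟩
  rw [Real.dist_eq, sub_zero, abs_of_nonneg measureReal_nonneg]
  refine lt_of_le_of_lt ((measureReal_mono fun ω hω => ?_).trans (ht k)) (half_lt_self hη)
  have hs : (0 : ℝ) < √((k + 1 : ℕ) : ℝ) := Real.sqrt_pos.2 (by positivity)
  simp only [Set.mem_ofPred_eq, Pi.sub_apply, Pi.zero_apply, sub_zero] at hω ⊢
  rw [← smul_sub, sub_sub_sub_cancel_right, norm_smul, norm_inv, Real.norm_of_nonneg hs.le,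
    inv_mul_eq_div, le_div_iff₀ hs] at hω
  have h1 := norm_vectorSN_sub_cornerVector_le (partialProd (fun j => A j ω) (k + 1))
  have h2 := hK (k + 1) (by omega)
  simp only [Function.comp_apply] at h2
  linarith

end Fluctuations

end PadicProducts

/-! ### The main theorem -/

theorem mainTheorem2 {p : ℕ} [Fact p.Prime] {n : ℕ}
    {Ω : Type*} [MeasurableSpace Ω] (P : Measure Ω) [IsProbabilityMeasure P]
    (A : ℕ → Ω → GL (Fin n) ℚ_[p])
    (hmeas : ∀ k, Measurable (A k))
    (hindep : iIndepFun A P)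
    (hident : ∀ k, IdentDistrib (A k) (A 0) P P)
    (hinv : PadicProducts.IsBiInvariant (P.map (A 0)))
    (hnonconst : ¬ ∀ᵐ ω ∂P, ∃ M : ℤ, ∀ i,
      PadicProducts.SN (A 0 ω : Matrix (Fin n) (Fin n) ℚ_[p]) i = M)
    (hint : ∀ i < n, Integrable (fun ω => (PadicProducts.cornerWeight (A 0 ω) i : ℝ)) P) :
    -- strictly ordered expectations of the increments
    (∀ i, i + 1 < n →
      (∫ ω, (PadicProducts.cornerWeight (A 0 ω) (i + 1) : ℝ) ∂P)
          - (∫ ω, (PadicProducts.cornerWeight (A 0 ω) (i + 2) : ℝ) ∂P)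
        < (∫ ω, (PadicProducts.cornerWeight (A 0 ω) i : ℝ) ∂P)
          - (∫ ω, (PadicProducts.cornerWeight (A 0 ω) (i + 1) : ℝ) ∂P)) ∧
    -- the sequence `v` is almost surely split
    (∀ᵐ ω ∂P, PadicProducts.IsSplit (fun j => A j ω)
      (PadicProducts.cornerSequence (fun j => A j ω))) ∧
    -- strong law of large numbers
    (∀ᵐ ω ∂P, ∀ i : Fin n,
      Tendsto
        (fun k : ℕ =>
          (PadicProducts.SN (PadicProducts.partialProd (fun j => A j ω) k :
            Matrix (Fin n) (Fin n) ℚ_[p]) i : ℝ) / k)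
        atTop
        (𝓝 ((∫ ω, (PadicProducts.cornerWeight (A 0 ω) i : ℝ) ∂P)
          - (∫ ω, (PadicProducts.cornerWeight (A 0 ω) (i + 1) : ℝ) ∂P)))) ∧
    -- central limit theorem
    ((∀ i < n, MemLp (fun ω => (PadicProducts.cornerWeight (A 0 ω) i : ℝ)) 2 P) →
      TendstoInDistribution
        (fun (k : ℕ) (ω : Ω) => WithLp.toLp 2 fun i : Fin n =>
          ((PadicProducts.SN (PadicProducts.partialProd (fun j => A j ω) k :
              Matrix (Fin n) (Fin n) ℚ_[p]) i : ℝ)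
            - k * ((∫ ω, (PadicProducts.cornerWeight (A 0 ω) i : ℝ) ∂P)
              - (∫ ω, (PadicProducts.cornerWeight (A 0 ω) (i + 1) : ℝ) ∂P))) / √(k : ℝ))
        atTop
        (id : EuclideanSpace ℝ (Fin n) → EuclideanSpace ℝ (Fin n))
        (fun _ => P)
        (multivariateGaussian 0 (Matrix.of fun i j : Fin n =>
          cov[fun ω => (PadicProducts.cornerWeight (A 0 ω) i : ℝ)
                - PadicProducts.cornerWeight (A 0 ω) (i + 1),
              fun ω => (PadicProducts.cornerWeight (A 0 ω) j : ℝ)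
                - PadicProducts.cornerWeight (A 0 ω) (j + 1); P]))) := by
  -- Corners with i ≥ n are empty and have weight 0, so the bounds on the index can be dropped.
  have hint' : ∀ i, Integrable (fun ω => (PadicProducts.cornerWeight (A 0 ω) i : ℝ)) P := by
    intro i
    rcases lt_or_ge i n with hi | hi
    · exact hint i hi
    · simp [PadicProducts.cornerWeight_of_le _ hi]
  have hlt : ∀ i, i + 1 < n →
      (∫ ω, (PadicProducts.cornerWeight (A 0 ω) (i + 1) : ℝ) ∂P)
          - (∫ ω, (PadicProducts.cornerWeight (A 0 ω) (i + 2) : ℝ) ∂P)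
        < (∫ ω, (PadicProducts.cornerWeight (A 0 ω) i : ℝ) ∂P)
          - (∫ ω, (PadicProducts.cornerWeight (A 0 ω) (i + 1) : ℝ) ∂P) := by
    intro i hi
    have hm : ∀ i, ∫ g, (PadicProducts.cornerWeight g i : ℝ) ∂(P.map (A 0))
        = ∫ ω, (PadicProducts.cornerWeight (A 0 ω) i : ℝ) ∂P := fun i =>
      integral_map (hmeas 0).aemeasurable
        (PadicProducts.measurable_cornerWeight i).aestronglyMeasurable
    have h := hinv.integral_cornerWeight_lt (fun i => (integrable_map_measure
      (PadicProducts.measurable_cornerWeight i).aestronglyMeasurable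
      (hmeas 0).aemeasurable).2 (hint' i))
      (fun h => hnonconst (ae_of_ae_map (hmeas 0).aemeasurable h)) i hi
    rwa [hm, hm, hm] at h
  refine ⟨hlt, PadicProducts.ae_isSplit hmeas hindep hident hinv hint' hlt, ?_, fun hL2 => ?_⟩
  · filter_upwards [PadicProducts.strong_law_tailSN hmeas hindep hident hinv hint'] with ω hω i
    refine ((hω i).sub (hω (i + 1))).congr fun k => ?_
    rw [PadicProducts.SN_eq_tailSN_sub, Int.cast_sub, sub_div]
  · have hL2' : ∀ i, MemLp (fun ω => (PadicProducts.cornerWeight (A 0 ω) i : ℝ)) 2 P := by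
      intro i
      rcases lt_or_ge i n with hi | hi
      · exact hL2 i hi
      · simp [PadicProducts.cornerWeight_of_le _ hi]
    have h := PadicProducts.tendstoInDistribution_vectorSN hmeas hindep hident hinv hL2'
    have he : ∀ (k : ℕ) (ω : Ω), (√(k : ℝ))⁻¹ •
        (PadicProducts.vectorSN (PadicProducts.partialProd (fun j => A j ω) k)
          - (k : ℝ) • WithLp.toLp 2 fun i => ∫ ω, PadicProducts.cornerVector (A 0 ω) i ∂P)
        = WithLp.toLp 2 fun i : Fin n =>
          ((PadicProducts.SN (PadicProducts.partialProd (fun j => A j ω) k :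
              Matrix (Fin n) (Fin n) ℚ_[p]) i : ℝ)
            - k * ((∫ ω, (PadicProducts.cornerWeight (A 0 ω) i : ℝ) ∂P)
              - (∫ ω, (PadicProducts.cornerWeight (A 0 ω) (i + 1) : ℝ) ∂P))) / √(k : ℝ) := by
      intro k ω
      ext i
      simp only [PadicProducts.vectorSN, PadicProducts.cornerVector, PiLp.smul_apply,
        PiLp.sub_apply, smul_eq_mul]
      rw [integral_sub (hint' i) (hint' (i + 1)), inv_mul_eq_div]
    simp_rw [he] at h
    exact h
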